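/- Let $n,l\in\mathbb N$, $p,r\in(0,\infty]$, $\sigma_1\in(0,\infty]$, $\sigma_2=p$, $\alpha_1,\alpha_2\in\mathbb R$, $\alpha_3\ge 0$. For $k\in\mathbb N_0$, $m\in\mathbb Z^n$ put $Q_{k,m}=\prod_{i=1}^n\bigl(\tfrac{m_i}{2^k},\tfrac{m_i+1}{2^k}\bigr)$, $\widetilde Q_{k,m}=\prod_{i=1}^n\bigl[\tfrac{m_i}{2^k},\tfrac{m_i+1}{2^k}\bigr)$. Let $t_k:\mathbb R^n\to(0,\infty)$, $k\in\mathbb N_0$, be measurable with $t_k\in L_p^{\rm loc}(\mathbb R^n)$, and set $t_{k,m}=\|t_k|L_p(Q_{k,m})\|$, $\overline t_k=2^{kn/p}\sum_m t_{k,m}\chi_{\widetilde Q_{k,m}}$ (throughout, expressions with an infinite exponent are read with essential suprema and suprema, and $2^{kn/\infty}=1$). Assume $\{t_k\}\in X^{\alpha_3}_{\alpha,\sigma,p}$, that is, there are $c_1,c_2>0$ such that for all $0\le k\le j$ and $m\in\mathbb Z^n$ $$\Bigl(2^{kn}\int_{Q_{k,m}}\overline t_k^{\,p}\Bigr)^{1/p}\Bigl(2^{kn}\int_{Q_{k,m}}\overline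 t_j^{\,-\sigma_1}\Bigr)^{1/\sigma_1}\le c_1 2^{\alpha_1(k-j)},\qquad \Bigl(2^{kn}\int_{Q_{k,m}}\overline t_k^{\,p}\Bigr)^{-1/p}\Bigl(2^{kn}\int_{Q_{k,m}}\overline t_j^{\,\sigma_2}\Bigr)^{1/\sigma_2}\le c_2 2^{\alpha_2(j-k)},$$ and $0<t_{k,m}\le 2^{\alpha_3}t_{k,\widetilde m}$ whenever $|m_i-\widetilde m_i|\le 1$ for $i=1,\dots,n$. For $\varphi\in L_r^{\rm loc}(\mathbb R^n)$ let $\Delta^l(h)\varphi(x)=\sum_{j=0}^l(-1)^{l+j}\binom lj\varphi(x+jh)$ and $$\delta^l_r(Q_{k,m})\varphi=\Bigl(2^{2kn}\int_{(-2^{-k},2^{-k})^n}\int_{Q_{k,m}}|\Delta^l(h)\varphi(x)|^r\,dx\,dh\Bigr)^{1/r}.$$ Let $N^{l}$ be the B-spline of degree $l$ with knots $0,1,\dots,l+1$, let $N^l_{k,m}(x)=\prod_{i=1}^nN^l(2^kx_i-m_i)$, and let $\Sigma^l_k$ be the set of all splines $\sum_{m\in\mathbb Z^n}\beta_mN^l_{k,m}$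 with $\beta_m\in\mathbb R$. Put $$s^{l+1}_k=\inf_{S\in\Sigma^l_k}\Bigl(\sum_{m\in\mathbb Z^n}t_{k,m}^p\,2^{knp/r}\|\varphi-S|L_r(Q_{k,m})\|^p\Bigr)^{1/p}\ (k\in\mathbb N_0),\qquad s^{l+1}_{-1}=\Bigl(\sum_{m\in\mathbb Z^n}t_{0,m}^p\|\varphi|L_r(Q_{0,m})\|^p\Bigr)^{1/p}.$$ Then there is a constant $C>0$, depending only on $n,l,p,r,\sigma_1,\alpha_1,\alpha_2,\alpha_3,c_1,c_2$ (and not on $\varphi$, $k$ or $\mu$), such that for all $k\in\mathbb N_0$ and all $0<\mu\le\min\{1,r,p\}$ $$\Bigl(\sum_{m\in\mathbb Z^n}t_{k,m}^p\bigl[\delta^l_r(Q_{k,m})\varphi\bigr]^p\Bigr)^{1/p}\le C\,2^{-k(l-\alpha_2)}\Bigl(\sum_{j=-1}^k2^{j\mu(l-\alpha_2)}\bigl(s_j^{l+1}\bigr)^\mu\Bigr)^{1/\mu}$$ (both sides may be infinite). -/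

import Mathlib

open MeasureTheory
open scoped ENNReal NNReal

namespace VarSmooth

noncomputable section

/-- Local `L_p`, `0 < p ≤ ∞`: measurable with finite `L_p` (quasi-)norm on every compact set. -/
def LocLp {n : ℕ} (f : (Fin n → ℝ) → ℝ) (p : ℝ≥0∞) : Prop :=
  ∀ K : Set (Fin n → ℝ), IsCompact K → MemLp f p (volume.restrict K)

/-- The open cube with lower corner `a` and side length `s`. -/
def openCube {n : ℕ} (a : Fin n → ℝ) (s : ℝ) : Set (Fin n → ℝ) :=
  Set.univ.pi fun i => Set.Ioo (a i) (a i + s)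

/-- The lower corner `m / 2^k` of the dyadic cubes with index `(k, m)`. -/
def corner {n : ℕ} (k : ℕ) (m : Fin n → ℤ) : Fin n → ℝ := fun i => (m i : ℝ) / 2 ^ k

/-- The open dyadic cube `Q_{k,m} = ∏ (m_i / 2^k, (m_i + 1) / 2^k)`. -/
def dyadicCube {n : ℕ} (k : ℕ) (m : Fin n → ℤ) : Set (Fin n → ℝ) :=
  openCube (corner k m) ((2 ^ k : ℝ)⁻¹)

/-- The half-open dyadic cube `∏ [m_i / 2^k, (m_i + 1) / 2^k)`. -/
def dyadicCubeHalfOpen {n : ℕ} (k : ℕ) (m : Fin n → ℤ) : Set (Fin n → ℝ) :=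
  Set.univ.pi fun i => Set.Ico ((m i : ℝ) / 2 ^ k) (((m i : ℝ) + 1) / 2 ^ k)

/-- The factor `2^{kn/p}`, equal to `1` for `p = ∞` (then `p.toReal = 0` and `x / 0 = 0`). -/
def scale (n k : ℕ) (p : ℝ≥0∞) : ℝ≥0∞ := (2 : ℝ≥0∞) ^ (((k : ℝ) * n) / p.toReal)

/-- The `l_p` (quasi-)norm of a family of elements of `[0, ∞]`, `0 < p ≤ ∞`. -/
def seqNorm {ι : Type*} (p : ℝ≥0∞) (a : ι → ℝ≥0∞) : ℝ≥0∞ :=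
  if p = ∞ then ⨆ i, a i else (∑' i, a i ^ p.toReal) ^ (1 / p.toReal)

/-- `δ^l_r(Q)φ = ( s^{-2n} ∫_{s I^n} ∫_Q |Δ^l(h)φ(x)|^r dx dh )^{1/r}` for the cube `Q` with lower
corner `a` and side length `s`, where `I^n = (-1,1)^n` and
`Δ^l(h)φ(x) = ∑_{j=0}^l (-1)^{l+j} C(l,j) φ(x + j h)` is the iterated forward difference; for
`r = ∞` it is the essential supremum over `(h, x) ∈ s I^n × Q` (the factor in front is then `1`). -/
def delta {n : ℕ} (l : ℕ) (r : ℝ≥0∞) (a : Fin n → ℝ) (s : ℝ) (φ : (Fin n → ℝ) → ℝ) : ℝ≥0∞ :=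
  ENNReal.ofReal s ^ (-(2 * (n : ℝ)) / r.toReal) *
    eLpNorm (fun q : (Fin n → ℝ) × (Fin n → ℝ) => (fwdDiff q.1)^[l] φ q.2) r
      ((volume.restrict (Set.univ.pi fun _ : Fin n => Set.Ioo (-s) s)).prod
        (volume.restrict (openCube a s)))

/-- `t_{k,m} = ‖t_k | L_p(Q_{k,m})‖`. -/
def assoc {n : ℕ} (p : ℝ≥0∞) (t : ℕ → (Fin n → ℝ) → ℝ) (k : ℕ) (m : Fin n → ℤ) : ℝ≥0∞ :=
  eLpNorm (t k) p (volume.restrict (dyadicCube k m))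

/-- The `p`-associated step weight `2^{kn/p} ∑_m t_{k,m} χ(x)`, `χ` the indicator of the half-open
dyadic cube with index `(k, m)`. -/
def assocWeight {n : ℕ} (p : ℝ≥0∞) (t : ℕ → (Fin n → ℝ) → ℝ) (k : ℕ) (x : Fin n → ℝ) : ℝ≥0∞ :=
  scale n k p * ∑' m : Fin n → ℤ, (dyadicCubeHalfOpen k m).indicator (fun _ => assoc p t k m) x

/-- `(2^{kn} ∫_{Q_{k,m}} f^q)^{1/q}`, the essential supremum over `Q_{k,m}` for `q = ∞`. -/
def cubeMean {n : ℕ} (k : ℕ) (m : Fin n → ℤ) (q : ℝ≥0∞) (f : (Fin n → ℝ) → ℝ≥0∞) : ℝ≥0∞ :=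
  scale n k q * eLpNorm f q (volume.restrict (dyadicCube k m))

/-- The weight class `X^{α₃}_{α,σ,p}`, `α = (α₁, α₂)`, `σ = (σ₁, σ₂)`, with the constants `c₁, c₂`
of its two integral conditions displayed. A weight sequence belongs to the class if this holds for
some `c₁, c₂ > 0`. -/
structure IsXClass {n : ℕ} (α₁ α₂ α₃ : ℝ) (σ₁ σ₂ p : ℝ≥0∞) (c₁ c₂ : ℝ)
    (t : ℕ → (Fin n → ℝ) → ℝ) : Prop where
  pos : ∀ k x, 0 < t k x
  admissible : ∀ k, LocLp (t k) p
  lower : ∀ (k j : ℕ) (m : Fin n → ℤ), k ≤ j →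
    cubeMean k m p (assocWeight p t k) * cubeMean k m σ₁ (fun x => (assocWeight p t j x)⁻¹)
      ≤ ENNReal.ofReal c₁ * (2 : ℝ≥0∞) ^ (α₁ * ((k : ℝ) - j))
  upper : ∀ (k j : ℕ) (m : Fin n → ℤ), k ≤ j →
    (cubeMean k m p (assocWeight p t k))⁻¹ * cubeMean k m σ₂ (assocWeight p t j)
      ≤ ENNReal.ofReal c₂ * (2 : ℝ≥0∞) ^ (α₂ * ((j : ℝ) - k))
  assoc_pos : ∀ (k : ℕ) (m : Fin n → ℤ), 0 < assoc p t k m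
  neighbour : ∀ (k : ℕ) (m m' : Fin n → ℤ), (∀ i, |m i - m' i| ≤ 1) →
    assoc p t k m ≤ (2 : ℝ≥0∞) ^ α₃ * assoc p t k m'

/-- The B-spline of degree `d` with knots `0, 1, …, d + 1`: the divided difference over the knots of
the truncated power `(t - ·)_+^d`, normalized so that the integer translates sum to `1`. -/
def bSpline (d : ℕ) (t : ℝ) : ℝ :=
  ((d.factorial : ℝ))⁻¹ * ∑ i ∈ Finset.range (d + 2),
    (-1) ^ i * ((d + 1).choose i : ℝ) * (if (i : ℝ) ≤ t then (t - i) ^ d else 0)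

/-- The tensor-product B-spline `N^d_{k,m}(x) = ∏ N^d(2^k (x_i - m_i / 2^k))`. -/
def tensorSpline {n : ℕ} (d k : ℕ) (m : Fin n → ℤ) (x : Fin n → ℝ) : ℝ :=
  ∏ i, bSpline d (2 ^ k * (x i - (m i : ℝ) / 2 ^ k))

/-- The set `Σ^d_k` of all splines `∑_m β_m N^d_{k,m}` with arbitrary real coefficients (at every
point only finitely many terms are nonzero). -/
def splineSpace (n d k : ℕ) : Set ((Fin n → ℝ) → ℝ) :=
  {S | ∃ β : (Fin n → ℤ) → ℝ, ∀ x, S x = ∑' m : Fin n → ℤ, β m * tensorSpline d k m x}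

/-- The weighted best approximation `s^l_k(φ)_{r,p}`, `k ≥ 0`, by splines of order `l`
(degree `l - 1`): the infimum over `S ∈ Σ^{l-1}_k` of
`( ∑_m t_{k,m}^p (2^{kn/r} ‖φ - S | L_r(Q_{k,m})‖)^p )^{1/p}`. -/
def splineApprox {n : ℕ} (l : ℕ) (r p : ℝ≥0∞) (t : ℕ → (Fin n → ℝ) → ℝ) (φ : (Fin n → ℝ) → ℝ)
    (k : ℕ) : ℝ≥0∞ :=
  ⨅ S ∈ splineSpace n (l - 1) k, seqNorm p fun m : Fin n → ℤ =>
    assoc p t k m *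
      (scale n k r * eLpNorm (fun x => φ x - S x) r (volume.restrict (dyadicCube k m)))

/-- The term `s_{-1}(φ)_{r,p} = ( ∑_m t_{0,m}^p ‖φ | L_r(Q_{0,m})‖^p )^{1/p}`. -/
def splineApproxInit {n : ℕ} (r p : ℝ≥0∞) (t : ℕ → (Fin n → ℝ) → ℝ) (φ : (Fin n → ℝ) → ℝ) :
    ℝ≥0∞ :=
  seqNorm p fun m : Fin n → ℤ =>
    assoc p t 0 m * eLpNorm φ r (volume.restrict (dyadicCube 0 m))

end

end VarSmooth

/-!
Write `φ` as `φ - S_k` plus the telescoping sum of `S_j - S_{j-1}`, `0 ≤ j ≤ k`, where `S_{-1} = 0`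
and `S_j` is a nearly best spline of level `j`. The increment `S_j - S_{j-1}` is, near each cube of
level `j`, a dilated combination of a fixed finite family of splines of degree `l` with jumps only
in their `l`-th derivatives. Each function of this family satisfies `|Δ^l(h)g| ≤ C |h|^l`, and on
the finite-dimensional span all quasi-norms are comparable, so the differences of level `k` of the
increment gain the factor `2^{l(j-k)}` against its `L_r` size at level `j`; passing from the weights
of level `k` to those of level `j` costs `2^{α₂(k-j)}`. The pieces are added up with the
`ν`-triangle inequality for `ν = min {1, r, p}`, and `ℓ_μ ⊆ ℓ_ν` gives the smaller exponents.
-/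

namespace VarSmooth

/-! ### Quasi-norms -/

section QuasiNorm

variable {ι κ X : Type*} {p : ℝ≥0∞} {μ : ℝ}

theorem rpow_sum_le_sum_rpow (s : Finset ι) (a : ι → ℝ≥0∞) (hμ : 0 < μ) (hμ1 : μ ≤ 1) :
    (∑ i ∈ s, a i) ^ μ ≤ ∑ i ∈ s, a i ^ μ :=
  Finset.le_sum_of_subadditive (fun x : ℝ≥0∞ => x ^ μ) (by simp [hμ])
    (fun x y => ENNReal.rpow_add_le_add_rpow x y hμ.le hμ1) s a

theorem rpow_sum_rpow_antitone (s : Finset ι) (a : ι → ℝ≥0∞) {ν : ℝ} (hμ : 0 < μ) (hμν : μ ≤ ν) :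
    (∑ i ∈ s, a i ^ ν) ^ (1 / ν) ≤ (∑ i ∈ s, a i ^ μ) ^ (1 / μ) := by
  have hν : 0 < ν := hμ.trans_le hμν
  have h := rpow_sum_le_sum_rpow s (fun i => a i ^ ν) (div_pos hμ hν) ((div_le_one hν).2 hμν)
  simp only [← ENNReal.rpow_mul, mul_div_cancel₀ μ hν.ne'] at h
  calc (∑ i ∈ s, a i ^ ν) ^ (1 / ν) = ((∑ i ∈ s, a i ^ ν) ^ (μ / ν)) ^ (1 / μ) := by
        rw [← ENNReal.rpow_mul]; congr 1; field_simp
    _ ≤ _ := ENNReal.rpow_le_rpow h (by positivity)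

theorem le_card_rpow_mul_sum_of_rpow_le {s : Finset ι} {x : ℝ≥0∞} {a : ι → ℝ≥0∞} (hμ : 0 < μ)
    (h : x ^ μ ≤ ∑ i ∈ s, a i ^ μ) : x ≤ (s.card : ℝ≥0∞) ^ μ⁻¹ * ∑ i ∈ s, a i := by
  have hle : ∑ i ∈ s, a i ^ μ ≤ s.card * (∑ i ∈ s, a i) ^ μ := by
    rw [← nsmul_eq_mul]
    exact Finset.sum_le_card_nsmul _ _ _ fun i hi =>
      ENNReal.rpow_le_rpow (Finset.single_le_sum (fun _ _ => zero_le) hi) hμ.le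
  calc x = (x ^ μ) ^ μ⁻¹ := (ENNReal.rpow_rpow_inv hμ.ne' x).symm
    _ ≤ (s.card * (∑ i ∈ s, a i) ^ μ) ^ μ⁻¹ :=
        ENNReal.rpow_le_rpow (h.trans hle) (inv_nonneg.2 hμ.le)
    _ = _ := by
        rw [ENNReal.mul_rpow_of_nonneg _ _ (inv_nonneg.2 hμ.le), ENNReal.rpow_rpow_inv hμ.ne']

theorem exists_isGreatest_exponent {p q : ℝ≥0∞} (hp : p ≠ 0) (hq : q ≠ 0) :
    ∃ μ : ℝ, 0 < μ ∧ IsGreatest {μ | μ ≤ 1 ∧ ENNReal.ofReal μ ≤ p ∧ ENNReal.ofReal μ ≤ q} μ := by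
  have htop : min 1 (min p q) ≠ ∞ := ne_top_of_le_ne_top ENNReal.one_ne_top (min_le_left _ _)
  have hmem (μ : ℝ) : μ ∈ {μ | μ ≤ 1 ∧ ENNReal.ofReal μ ≤ p ∧ ENNReal.ofReal μ ≤ q} ↔
      μ ≤ (min 1 (min p q)).toReal := by
    rw [← ENNReal.ofReal_le_iff_le_toReal htop]
    simp
  exact ⟨_, ENNReal.toReal_pos (by simp [hp, hq]) htop, (hmem _).2 le_rfl,
    fun μ hμ => (hmem μ).1 hμ⟩

section eLpNorm

variable [MeasurableSpace X] {ν : Measure X} {ε ε' : Type*} [ENorm ε] [TopologicalSpace ε']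
  [ContinuousENorm ε']

theorem eLpNorm_rpow_le_sum (hμ : 0 < μ) (hμp : ENNReal.ofReal μ ≤ p) {s : Finset ι} {F : X → ε}
    {f : ι → X → ε'} (hf : ∀ i ∈ s, AEStronglyMeasurable (f i) ν)
    (hle : ∀ᵐ x ∂ν, ‖F x‖ₑ ^ μ ≤ ∑ i ∈ s, ‖f i x‖ₑ ^ μ) :
    eLpNorm F p ν ^ μ ≤ ∑ i ∈ s, eLpNorm (f i) p ν ^ μ := by
  have hμ0 : ENNReal.ofReal μ ≠ 0 := by simpa using hμ
  obtain ⟨q, hq, rfl⟩ : ∃ q, 1 ≤ q ∧ q * ENNReal.ofReal μ = p :=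
    ⟨p / ENNReal.ofReal μ,
      (ENNReal.le_div_iff_mul_le (Or.inl hμ0) (Or.inl ENNReal.ofReal_ne_top)).2
        (by simpa using hμp),
      ENNReal.div_mul_cancel hμ0 ENNReal.ofReal_ne_top⟩
  simp only [← eLpNorm_enorm_rpow _ hμ]
  calc _ ≤ eLpNorm (∑ i ∈ s, fun x => ‖f i x‖ₑ ^ μ) q ν :=
        eLpNorm_mono_enorm_ae (by filter_upwards [hle] with x hx; simpa using hx)
    _ ≤ _ := eLpNorm_sum_le
        (fun i hi => ((hf i hi).enorm.pow_const μ).aestronglyMeasurable) hq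

theorem eLpNorm_rpow_le_sum_of_enorm_le (hμ : 0 < μ) (hμ1 : μ ≤ 1) (hμp : ENNReal.ofReal μ ≤ p)
    {s : Finset ι} {F : X → ε} {f : ι → X → ε'} (hf : ∀ i ∈ s, AEStronglyMeasurable (f i) ν)
    (hle : ∀ᵐ x ∂ν, ‖F x‖ₑ ≤ ∑ i ∈ s, ‖f i x‖ₑ) :
    eLpNorm F p ν ^ μ ≤ ∑ i ∈ s, eLpNorm (f i) p ν ^ μ :=
  eLpNorm_rpow_le_sum hμ hμp hf <| hle.mono fun _ hx =>
    (ENNReal.rpow_le_rpow hx hμ.le).trans (rpow_sum_le_sum_rpow s _ hμ hμ1)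

theorem exists_eLpNorm_le_mul_sum (hp : p ≠ 0) (s : Finset ι) :
    ∃ C : ℝ≥0, ∀ (F : X → ε) (f : ι → X → ε') (ν : Measure X),
      (∀ i ∈ s, AEStronglyMeasurable (f i) ν) → (∀ᵐ x ∂ν, ‖F x‖ₑ ≤ ∑ i ∈ s, ‖f i x‖ₑ) →
      eLpNorm F p ν ≤ C * ∑ i ∈ s, eLpNorm (f i) p ν := by
  obtain ⟨μ, hμ, ⟨hμ1, hμp, -⟩, -⟩ := exists_isGreatest_exponent hp hp
  refine ⟨(s.card : ℝ≥0) ^ μ⁻¹, fun F f ν hf hle => ?_⟩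
  rw [ENNReal.coe_rpow_of_nonneg _ (inv_nonneg.2 hμ.le), ENNReal.coe_natCast]
  exact le_card_rpow_mul_sum_of_rpow_le hμ (eLpNorm_rpow_le_sum_of_enorm_le hμ hμ1 hμp hf hle)

end eLpNorm

theorem seqNorm_eq_eLpNorm (hp : p ≠ 0) (a : ι → ℝ≥0∞) :
    seqNorm p a = @eLpNorm ι ℝ≥0∞ _ ⊤ a p (@Measure.count ι ⊤) := by
  let _ : MeasurableSpace ι := ⊤
  unfold seqNorm
  split_ifs with h
  · subst h; simp [eLpNormEssSup_count]
  · rw [eLpNorm_eq_lintegral_rpow_enorm_toReal hp h]; simp [lintegral_count]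

theorem seqNorm_mono (hp : p ≠ 0) {a b : ι → ℝ≥0∞} (h : ∀ i, a i ≤ b i) :
    seqNorm p a ≤ seqNorm p b := by
  rw [seqNorm_eq_eLpNorm hp, seqNorm_eq_eLpNorm hp]
  let _ : MeasurableSpace ι := ⊤
  exact eLpNorm_mono_enorm fun i => by simpa using h i

theorem seqNorm_rpow_le_sum (hμ : 0 < μ) (hμp : ENNReal.ofReal μ ≤ p) {s : Finset κ}
    {F : ι → ℝ≥0∞} {f : κ → ι → ℝ≥0∞} (hle : ∀ x, F x ^ μ ≤ ∑ i ∈ s, f i x ^ μ) :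
    seqNorm p F ^ μ ≤ ∑ i ∈ s, seqNorm p (f i) ^ μ := by
  have hp : p ≠ 0 := ((ENNReal.ofReal_pos.2 hμ).trans_le hμp).ne'
  simp only [seqNorm_eq_eLpNorm hp]
  let _ : MeasurableSpace ι := ⊤
  exact eLpNorm_rpow_le_sum hμ hμp (fun i _ => measurable_from_top.aestronglyMeasurable)
    (Filter.Eventually.of_forall hle)

theorem exists_seqNorm_sum_le (hp : p ≠ 0) (s : Finset κ) :
    ∃ C : ℝ≥0, ∀ f : κ → ι → ℝ≥0∞,
      seqNorm p (fun x => ∑ i ∈ s, f i x) ≤ C * ∑ i ∈ s, seqNorm p (f i) := by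
  simp only [seqNorm_eq_eLpNorm hp]
  let _ : MeasurableSpace ι := ⊤
  obtain ⟨C, hC⟩ := exists_eLpNorm_le_mul_sum (X := ι) (ε := ℝ≥0∞) (ε' := ℝ≥0∞) hp s
  exact ⟨C, fun f => hC _ f _ (fun i _ => measurable_from_top.aestronglyMeasurable)
    (Filter.Eventually.of_forall fun _ => le_rfl)⟩

theorem seqNorm_const_mul (hp : p ≠ 0) (c : ℝ≥0∞) (a : ι → ℝ≥0∞) :
    seqNorm p (fun i => c * a i) = c * seqNorm p a := by
  unfold seqNorm
  split_ifs with h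
  · rw [ENNReal.mul_iSup]
  · have := ENNReal.toReal_pos hp h
    simp only [ENNReal.mul_rpow_of_nonneg _ _ this.le]
    rw [ENNReal.tsum_mul_left, ENNReal.mul_rpow_of_nonneg _ _ (by positivity),
      ← ENNReal.rpow_mul, mul_one_div_cancel this.ne', ENNReal.rpow_one]

theorem seqNorm_comp_equiv (e : ι ≃ κ) (a : κ → ℝ≥0∞) :
    seqNorm p (fun i => a (e i)) = seqNorm p a := by
  unfold seqNorm
  split_ifs with h
  · exact e.iSup_comp (g := a)
  · congr 1; exact e.tsum_eq (fun i => a i ^ p.toReal)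

end QuasiNorm

/-! ### Local bounds for iterated differences -/

section Differences

variable {E E' : Type*} [NormedAddCommGroup E] [NormedAddCommGroup E'] {l q : ℕ}

theorem fwdDiff_iter_comp_affine (f : E' → ℝ) {A : E → E'} {h : E} {h' : E'}
    (hA : ∀ x, A (x + h) = A x + h') (q : ℕ) (x : E) :
    (fwdDiff h)^[q] (fun y => f (A y)) x = (fwdDiff h')^[q] f (A x) := by
  induction q generalizing f with
  | zero => rfl
  | succ q ih =>
    have e : fwdDiff h (fun y => f (A y)) = fun y => fwdDiff h' f (A y) := by
      funext y
      simp [fwdDiff, hA]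
    rw [Function.iterate_succ_apply, Function.iterate_succ_apply, e, ih]

theorem fwdDiff_iter_const_eq_zero (h : E) (c : ℝ) (q : ℕ) :
    (fwdDiff h)^[q + 1] (fun _ : E => c) = fun _ => 0 := by
  induction q generalizing c with
  | zero => simp
  | succ q ih => rw [Function.iterate_succ_apply, fwdDiff_const, ih]

theorem fwdDiff_iter_congr {f g : E → ℝ} {h x : E}
    (hfg : ∀ i ≤ q, f (x + i • h) = g (x + i • h)) :
    (fwdDiff h)^[q] f x = (fwdDiff h)^[q] g x := by
  rw [fwdDiff_iter_eq_sum_shift, fwdDiff_iter_eq_sum_shift]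
  refine Finset.sum_congr rfl fun i hi => ?_
  rw [hfg i (by simpa [Nat.lt_succ_iff] using hi)]

theorem enorm_fwdDiff_iter_le (f : E → ℝ) (h x : E) (q : ℕ) :
    ‖(fwdDiff h)^[q] f x‖ₑ ≤ ∑ i ∈ Finset.range (q + 1), ‖q.choose i * f (x + i • h)‖ₑ := by
  rw [fwdDiff_iter_eq_sum_shift]
  refine (enorm_sum_le _ _).trans_eq (Finset.sum_congr rfl fun i _ => ?_)
  simp [enorm_mul, enorm_pow]

theorem abs_fwdDiff_iter_le {f : E → ℝ} {h x : E} {M : ℝ}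
    (hf : ∀ i ≤ q, |f (x + i • h)| ≤ M) : |(fwdDiff h)^[q] f x| ≤ 2 ^ q * M := by
  rw [fwdDiff_iter_eq_sum_shift]
  calc |∑ i ∈ Finset.range (q + 1), ((-1 : ℤ) ^ (q - i) * q.choose i) • f (x + i • h)|
      ≤ ∑ i ∈ Finset.range (q + 1), (q.choose i : ℝ) * M := by
        refine (Finset.abs_sum_le_sum_abs _ _).trans (Finset.sum_le_sum fun i hi => ?_)
        simp only [zsmul_eq_mul, abs_mul, Int.cast_mul, Int.cast_pow, Int.cast_neg, Int.cast_one,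
          abs_pow, abs_neg, abs_one, one_pow, one_mul, Int.cast_natCast, Nat.abs_cast]
        gcongr
        exact hf i (Finset.mem_range_succ_iff.1 hi)
    _ = 2 ^ q * M := by
        rw [← Finset.sum_mul]
        exact_mod_cast congrArg (fun N : ℕ => (N : ℝ) * M) (Nat.sum_range_choose q)

theorem abs_fwdDiff_iter_mul_le {f g : E → ℝ} {h x : E} {K L ρ : ℝ}
    (hf : ∀ a i, a + i ≤ q → |(fwdDiff h)^[a] f (x + i • h)| ≤ K * ρ ^ a)
    (hg : ∀ a i, a + i ≤ q → |(fwdDiff h)^[a] g (x + i • h)| ≤ L * ρ ^ a) :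
    |(fwdDiff h)^[q] (fun y => f y * g y) x| ≤ 2 ^ q * (K * L) * ρ ^ q := by
  induction q generalizing f g K L x with
  | zero =>
    have hfx := hf 0 0 le_rfl
    have hgx := hg 0 0 le_rfl
    simp only [Function.iterate_zero, id_eq, pow_zero, mul_one, one_mul, abs_mul, zero_smul,
      add_zero] at *
    exact mul_le_mul hfx hgx (abs_nonneg _) ((abs_nonneg _).trans hfx)
  | succ q ih =>
    have leibniz : fwdDiff h (fun y => f y * g y) =
        (fun y => fwdDiff h f y * g (y + h)) + (fun y => f y * fwdDiff h g y) := by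
      funext y
      simp only [fwdDiff, Pi.add_apply]
      ring
    have hΔ {u : E → ℝ} {N : ℝ}
        (hu : ∀ a i, a + i ≤ q + 1 → |(fwdDiff h)^[a] u (x + i • h)| ≤ N * ρ ^ a) (a i : ℕ)
        (hai : a + i ≤ q) : |(fwdDiff h)^[a] (fwdDiff h u) (x + i • h)| ≤ N * ρ * ρ ^ a := by
      rw [← Function.iterate_succ_apply, mul_assoc, ← pow_succ']
      exact hu (a + 1) i (by omega)
    have hshift (a i : ℕ) (hai : a + i ≤ q) :
        |(fwdDiff h)^[a] (fun y => g (y + h)) (x + i • h)| ≤ L * ρ ^ a := by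
      rw [fwdDiff_iter_comp_affine g (fun _ => rfl), add_assoc, ← succ_nsmul]
      exact hg a (i + 1) (by omega)
    rw [Function.iterate_succ_apply, leibniz, fwdDiff_iter_add, Pi.add_apply]
    calc _ ≤ 2 ^ q * (K * ρ * L) * ρ ^ q + 2 ^ q * (K * (L * ρ)) * ρ ^ q :=
          (abs_add_le _ _).trans (add_le_add (ih (hΔ hf) hshift)
            (ih (fun a i hai => hf a i (by omega)) (hΔ hg)))
      _ = _ := by ring

/-- The iterated differences of `f` of order `q ≤ l` are `O(‖h‖ ^ q)` locally uniformly: the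
regularity of a spline of degree `l`, weaker than `C^l` so that the break points cause no case
distinction. -/
def LocDiffBound (l : ℕ) (f : E → ℝ) : Prop :=
  ∀ R : ℝ, ∃ K : ℝ≥0, ∀ q ≤ l, ∀ h x : E, ‖h‖ ≤ 1 → ‖x‖ ≤ R →
    |(fwdDiff h)^[q] f x| ≤ K * ‖h‖ ^ q

namespace LocDiffBound

protected theorem const (c : ℝ) : LocDiffBound l (fun _ : E => c) := by
  refine fun R => ⟨‖c‖₊, fun q _ h x _ _ => ?_⟩
  cases q with
  | zero => simp
  | succ q => rw [fwdDiff_iter_const_eq_zero]; simp only [abs_zero]; positivity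

protected theorem add {f g : E → ℝ} (hf : LocDiffBound l f) (hg : LocDiffBound l g) :
    LocDiffBound l (fun x => f x + g x) := by
  intro R
  obtain ⟨K, hK⟩ := hf R
  obtain ⟨L, hL⟩ := hg R
  refine ⟨K + L, fun q hq h x hh hx => ?_⟩
  have hadd : (fwdDiff h)^[q] (fun x => f x + g x) x = (fwdDiff h)^[q] f x + (fwdDiff h)^[q] g x :=
    congrFun (fwdDiff_iter_add h f g q) x
  rw [hadd, NNReal.coe_add, add_mul]
  exact (abs_add_le _ _).trans (add_le_add (hK q hq h x hh hx) (hL q hq h x hh hx))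

protected theorem mul {f g : E → ℝ} (hf : LocDiffBound l f) (hg : LocDiffBound l g) :
    LocDiffBound l (fun x => f x * g x) := by
  intro R
  obtain ⟨K, hK⟩ := hf (R + l)
  obtain ⟨L, hL⟩ := hg (R + l)
  refine ⟨2 ^ l * (K * L), fun q hq h x hh hx => ?_⟩
  have horbit (a i : ℕ) (hai : a + i ≤ q) : ‖x + i • h‖ ≤ R + l :=
    calc ‖x + i • h‖ ≤ ‖x‖ + i * ‖h‖ := (norm_add_le _ _).trans (by gcongr; exact norm_nsmul_le)
      _ ≤ R + l * 1 := by gcongr; omega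
      _ = R + l := by rw [mul_one]
  refine (abs_fwdDiff_iter_mul_le (fun a i hai => hK a (by omega) h _ hh (horbit a i hai))
    (fun a i hai => hL a (by omega) h _ hh (horbit a i hai))).trans ?_
  push_cast
  gcongr
  norm_num

protected theorem finset_sum {ι : Type*} (s : Finset ι) {f : ι → E → ℝ}
    (hf : ∀ i ∈ s, LocDiffBound l (f i)) : LocDiffBound l (fun x => ∑ i ∈ s, f i x) := by
  classical
  induction s using Finset.induction_on with
  | empty => simpa using LocDiffBound.const 0
  | insert a s ha ih =>
    simp only [Finset.sum_insert ha]
    exact (hf a (by simp)).add (ih fun i hi => hf i (by simp [hi]))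

protected theorem finset_prod {ι : Type*} (s : Finset ι) {f : ι → E → ℝ}
    (hf : ∀ i ∈ s, LocDiffBound l (f i)) : LocDiffBound l (fun x => ∏ i ∈ s, f i x) := by
  classical
  induction s using Finset.induction_on with
  | empty => simpa using LocDiffBound.const 1
  | insert a s ha ih =>
    simp only [Finset.prod_insert ha]
    exact (hf a (by simp)).mul (ih fun i hi => hf i (by simp [hi]))

theorem comp_affine {f : E' → ℝ} (hf : LocDiffBound l f) {A B : E → E'} {c : ℝ}
    (hA : ∀ x h, A (x + h) = A x + B h) (hB : ∀ h, ‖B h‖ ≤ ‖h‖) (hAc : ∀ x, ‖A x‖ ≤ ‖x‖ + c) :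
    LocDiffBound l (fun x => f (A x)) := by
  intro R
  obtain ⟨K, hK⟩ := hf (R + c)
  refine ⟨K, fun q hq h x hh hx => ?_⟩
  rw [fwdDiff_iter_comp_affine f fun x => hA x h]
  refine (hK q hq _ _ ((hB h).trans hh) ((hAc x).trans (by linarith))).trans ?_
  gcongr
  exact hB h

end LocDiffBound

theorem locDiffBound_id : LocDiffBound l (fun t : ℝ => t) := by
  refine fun R => ⟨max R.toNNReal 1, fun q _ h x _ hx => ?_⟩
  match q with
  | 0 => simpa using Or.inl (Or.inl hx)
  | 1 => simpa [fwdDiff] using le_mul_of_one_le_left (abs_nonneg h) (le_max_right (max R 0) 1)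
  | q + 2 =>
    have : fwdDiff h (fun t : ℝ => t) = fun _ => h := by funext t; simp [fwdDiff]
    rw [Function.iterate_succ_apply, this, fwdDiff_iter_const_eq_zero]
    simp only [abs_zero]; positivity

theorem locDiffBound_pow (d : ℕ) : LocDiffBound l (fun t : ℝ => t ^ d) := by
  simpa using LocDiffBound.finset_prod (l := l) (Finset.range d) (f := fun _ (t : ℝ) => t)
    (fun _ _ => locDiffBound_id)

theorem max_zero_le_of_orbit_nonpos {x h : ℝ} {a i : ℕ} (hi : i ≤ q) (ha : a ≤ q)
    (hx : x + a • h ≤ 0) : max (x + i • h) 0 ≤ q * |h| := by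
  refine max_le ?_ (by positivity)
  have hdist : |(i : ℝ) - a| ≤ q := by
    rw [abs_le]
    constructor <;> linarith [(Nat.cast_le (α := ℝ)).2 hi, (Nat.cast_le (α := ℝ)).2 ha,
      Nat.cast_nonneg (α := ℝ) i, Nat.cast_nonneg (α := ℝ) a]
  simp only [nsmul_eq_mul] at *
  calc x + i * h ≤ (i - a) * h := by linarith
    _ ≤ |(i : ℝ) - a| * |h| := (le_abs_self _).trans_eq (abs_mul _ _)
    _ ≤ q * |h| := by gcongr

theorem locDiffBound_truncatedPow : LocDiffBound l (fun t : ℝ => max t 0 ^ l) := by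
  intro R
  obtain ⟨K, hK⟩ := locDiffBound_pow (l := l) l R
  refine ⟨max K (2 ^ l * l ^ l), fun q hq h x hh hx => ?_⟩
  rw [Real.norm_eq_abs] at hh hx ⊢
  by_cases hpos : ∀ i ≤ q, 0 ≤ x + i • h
  · rw [fwdDiff_iter_congr (g := fun t => t ^ l) fun i hi => by simp only [max_eq_left (hpos i hi)]]
    refine (hK q hq h x hh hx).trans ?_
    rw [Real.norm_eq_abs]
    gcongr
    exact le_max_left _ _
  -- once the orbit meets the zero set of the power, all its values there are `O(|h| ^ l)`
  · push Not at hpos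
    obtain ⟨a, ha, hxa⟩ := hpos
    have hsmall : ∀ i ≤ q, |max (x + i • h) 0 ^ l| ≤ (l * |h|) ^ l := fun i hi => by
      rw [abs_pow, abs_of_nonneg (le_max_right _ _)]
      gcongr
      exact max_zero_le_of_orbit_nonpos (hi.trans hq) (ha.trans hq) hxa.le
    calc _ ≤ 2 ^ q * (l * |h|) ^ l := abs_fwdDiff_iter_le hsmall
      _ ≤ 2 ^ l * (l * |h|) ^ l := by gcongr; norm_num
      _ = 2 ^ l * l ^ l * |h| ^ l := by rw [mul_pow, mul_assoc]
      _ ≤ (max K (2 ^ l * l ^ l) : ℝ≥0) * |h| ^ q := by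
          push_cast
          exact mul_le_mul (le_max_right _ _) (pow_le_pow_of_le_one (abs_nonneg _) hh hq)
            (by positivity) (by positivity)

end Differences

/-! ### B-splines -/

section BSpline

variable {d n : ℕ}

theorem bSpline_eq_sum (hd : 1 ≤ d) (t : ℝ) :
    bSpline d t = ∑ i ∈ Finset.range (d + 2),
      ((d.factorial : ℝ)⁻¹ * ((-1) ^ i * ((d + 1).choose i : ℝ))) * max (t + -(i : ℝ)) 0 ^ d := by
  rw [bSpline, Finset.mul_sum]
  refine Finset.sum_congr rfl fun i _ => ?_
  split_ifs with h
  · rw [max_eq_left (by linarith)]; ring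
  · rw [max_eq_right (by linarith), zero_pow (by omega)]; ring

theorem continuous_bSpline (hd : 1 ≤ d) : Continuous (bSpline d) := by
  simp only [funext (bSpline_eq_sum hd)]
  fun_prop

theorem locDiffBound_bSpline (hd : 1 ≤ d) : LocDiffBound d (bSpline d) := by
  rw [funext (bSpline_eq_sum hd)]
  refine LocDiffBound.finset_sum _ fun i _ => (LocDiffBound.const _).mul ?_
  exact locDiffBound_truncatedPow.comp_affine (A := fun t : ℝ => t + -(i : ℝ)) (B := id) (c := i)
    (fun x h => by simp only [id]; ring) (fun _ => le_rfl)
    (fun x => (norm_add_le _ _).trans (by simp))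

theorem bSpline_eq_zero_of_neg (d : ℕ) {t : ℝ} (ht : t < 0) : bSpline d t = 0 := by
  rw [bSpline, Finset.sum_eq_zero, mul_zero]
  intro i _
  rw [if_neg (not_le.2 (ht.trans_le i.cast_nonneg)), mul_zero]

theorem sum_neg_one_pow_mul_choose_mul_sub_pow (d : ℕ) (t : ℝ) :
    ∑ i ∈ Finset.range (d + 2), (-1) ^ i * ((d + 1).choose i : ℝ) * (t - i) ^ d = 0 := by
  have hdeg : ((Polynomial.C t - Polynomial.X : Polynomial ℝ) ^ d).natDegree < d + 1 := by
    have h1 : (Polynomial.C t - Polynomial.X : Polynomial ℝ).natDegree ≤ 1 := by compute_degree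
    calc _ ≤ d * (Polynomial.C t - Polynomial.X : Polynomial ℝ).natDegree :=
          Polynomial.natDegree_pow_le
      _ ≤ d * 1 := by gcongr
      _ < d + 1 := by omega
  have hdiff := congrFun (Polynomial.fwdDiff_iter_eq_zero_of_degree_lt hdeg) 0
  rw [fwdDiff_iter_eq_sum_shift] at hdiff
  refine (mul_eq_zero_iff_left (pow_ne_zero (d + 1) (neg_ne_zero.2 one_ne_zero) :
    (-1 : ℝ) ^ (d + 1) ≠ 0)).1 (hdiff.symm.trans ?_).symm
  rw [Finset.mul_sum]
  refine Finset.sum_congr rfl fun i hi => ?_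
  have hsign : (-1 : ℝ) ^ (d + 1 - i) = (-1) ^ i * (-1) ^ (d + 1) := by
    obtain ⟨j, hj⟩ := Nat.exists_eq_add_of_le (Finset.mem_range_succ_iff.1 hi)
    rw [hj, Nat.add_sub_cancel_left, pow_add, ← mul_assoc, ← mul_pow]; simp
  simp only [zsmul_eq_mul, Polynomial.eval_pow, Polynomial.eval_sub, Polynomial.eval_C,
    Polynomial.eval_X, nsmul_eq_mul, mul_one, zero_add, Int.cast_mul, Int.cast_pow, Int.cast_neg,
    Int.cast_one, Int.cast_natCast, hsign]
  ring

theorem bSpline_eq_zero_of_ge (d : ℕ) {t : ℝ} (ht : (d : ℝ) + 1 ≤ t) : bSpline d t = 0 := by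
  rw [bSpline, Finset.sum_congr rfl fun i hi => ?_, sum_neg_one_pow_mul_choose_mul_sub_pow d t,
    mul_zero]
  have hi' : (i : ℝ) ≤ d + 1 := by exact_mod_cast Finset.mem_range_succ_iff.1 hi
  rw [if_pos (hi'.trans ht)]

/-- The cardinal tensor-product B-spline `∏ N^d(x_i)`, of which every `N^d_{k,m}` is an affine
image. -/
noncomputable def cardSpline (d : ℕ) (x : Fin n → ℝ) : ℝ := ∏ i, bSpline d (x i)

theorem continuous_cardSpline (hd : 1 ≤ d) : Continuous (cardSpline (n := n) d) := by
  have := continuous_bSpline hd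
  unfold cardSpline
  fun_prop

theorem locDiffBound_cardSpline (hd : 1 ≤ d) : LocDiffBound d (cardSpline (n := n) d) :=
  LocDiffBound.finset_prod _ fun i _ => (locDiffBound_bSpline hd).comp_affine
    (A := fun x : Fin n → ℝ => x i) (B := fun h => h i) (c := 0) (fun _ _ => rfl)
    (fun h => norm_le_pi_norm h i) (fun x => by simpa using norm_le_pi_norm x i)

theorem cardSpline_eq_zero {x : Fin n → ℝ} (i : Fin n) (h : x i < 0 ∨ (d : ℝ) + 1 ≤ x i) :
    cardSpline d x = 0 :=
  Finset.prod_eq_zero (Finset.mem_univ i)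
    (h.elim (bSpline_eq_zero_of_neg d) (bSpline_eq_zero_of_ge d))

end BSpline

/-! ### Coefficient bounds in finite-dimensional function spaces -/

section CoefficientBound

variable {X E ι : Type*} [MeasurableSpace X] {ν : Measure X} {r : ℝ≥0∞}

section Injective

variable [NormedAddCommGroup E] [NormedSpace ℝ E] [FiniteDimensional ℝ E] {T : E →ₗ[ℝ] X → ℝ}

theorem eLpNorm_le_liminf_of_tendsto (hT : ∀ c, AEStronglyMeasurable (T c) ν) {u : ℕ → E} {v : E}
    (hu : Filter.Tendsto u Filter.atTop (nhds v)) :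
    eLpNorm (T v) r ν ≤ Filter.liminf (fun N => eLpNorm (T (u N)) r ν) Filter.atTop :=
  Lp.eLpNorm_lim_le_liminf_eLpNorm (fun N => hT (u N)) (T v) <| Filter.Eventually.of_forall fun x =>
    ((LinearMap.proj x ∘ₗ T).continuous_of_finiteDimensional.tendsto v).comp hu

theorem exists_one_le_mul_eLpNorm_of_norm_eq_one (hT : ∀ c, AEStronglyMeasurable (T c) ν)
    (hinj : ∀ c, eLpNorm (T c) r ν = 0 → c = 0) :
    ∃ C : ℝ≥0, ∀ c, ‖c‖ = 1 → 1 ≤ C * eLpNorm (T c) r ν := by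
  by_contra! H
  choose u hu1 hsmall using fun N : ℕ => H N
  obtain ⟨v, hv, φ, hφ, hlim⟩ := (isCompact_sphere (0 : E) 1).tendsto_subseq (x := u)
    fun N => by simpa using hu1 N
  have hbound (N : ℕ) : eLpNorm (T (u N)) r ν ≤ (N : ℝ≥0∞)⁻¹ := by
    rw [ENNReal.le_inv_iff_mul_le, mul_comm]
    exact_mod_cast (hsmall N).le
  have hzero : Filter.Tendsto (fun N => eLpNorm (T (u (φ N))) r ν) Filter.atTop (nhds 0) :=
    tendsto_of_tendsto_of_tendsto_of_le_of_le tendsto_const_nhds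
      (ENNReal.tendsto_inv_nat_nhds_zero.comp hφ.tendsto_atTop) (fun _ => zero_le)
      fun N => hbound (φ N)
  have hv0 : v = 0 := hinj v <| nonpos_iff_eq_zero.1 <|
    (eLpNorm_le_liminf_of_tendsto hT hlim).trans_eq hzero.liminf_eq
  simp [hv0] at hv

theorem exists_enorm_le_mul_eLpNorm (hT : ∀ c, AEStronglyMeasurable (T c) ν)
    (hinj : ∀ c, eLpNorm (T c) r ν = 0 → c = 0) :
    ∃ C : ℝ≥0, ∀ c, ‖c‖ₑ ≤ C * eLpNorm (T c) r ν := by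
  obtain ⟨C, hC⟩ := exists_one_le_mul_eLpNorm_of_norm_eq_one hT hinj
  refine ⟨C, fun c => ?_⟩
  obtain rfl | hc := eq_or_ne c 0
  · simp
  have hnorm : ‖c‖ ≠ 0 := norm_ne_zero_iff.2 hc
  have hone := hC (‖c‖⁻¹ • c) (by rw [norm_smul, norm_inv, norm_norm, inv_mul_cancel₀ hnorm])
  calc ‖c‖ₑ = ‖c‖ₑ * 1 := (mul_one _).symm
    _ ≤ ‖c‖ₑ * (C * eLpNorm (T (‖c‖⁻¹ • c)) r ν) := by gcongr
    _ = C * eLpNorm (‖c‖ • T (‖c‖⁻¹ • c)) r ν := by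
        rw [eLpNorm_const_smul, enorm_norm, mul_left_comm]
    _ = C * eLpNorm (T c) r ν := by rw [← map_smul, smul_inv_smul₀ hnorm]

end Injective

variable [TopologicalSpace X] [OpensMeasurableSpace X] [Fintype ι] [ν.IsOpenPosMeasure]
  {F : ι → X → ℝ} {U : Set X}

theorem exists_coeff_enorm_le_mul_eLpNorm (hF : ∀ i, Continuous (F i)) (hU : IsOpen U)
    (hr : r ≠ 0) :
    ∃ C : ℝ≥0, ∀ c : ι → ℝ, ∃ c' : ι → ℝ,
      Set.EqOn (∑ i, c i • F i) (∑ i, c' i • F i) U ∧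
      ‖c'‖ₑ ≤ C * eLpNorm (∑ i, c i • F i) r (ν.restrict U) := by
  let T : (ι → ℝ) →ₗ[ℝ] X → ℝ := Fintype.linearCombination ℝ F
  let restr : (X → ℝ) →ₗ[ℝ] U → ℝ := LinearMap.funLeft ℝ ℝ Subtype.val
  have hTcont (c : ι → ℝ) : Continuous (T c) := by
    rw [Fintype.linearCombination_apply, Finset.sum_fn]
    exact continuous_finsetSum _ fun i _ => (hF i).const_smul (c i)
  obtain ⟨W, hW⟩ := (LinearMap.ker (restr ∘ₗ T)).exists_isCompl
  obtain ⟨C, hC⟩ := exists_enorm_le_mul_eLpNorm (T := T ∘ₗ W.subtype) (ν := ν.restrict U) (r := r)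
    (fun c => (hTcont c).aestronglyMeasurable) fun c hc => by
      have hzero : Set.EqOn (T c) 0 U := Measure.eqOn_open_of_ae_eq
        ((eLpNorm_eq_zero_iff (hTcont c).aestronglyMeasurable hr).1 hc) hU
        (hTcont c).continuousOn continuousOn_const
      exact Subtype.ext <| Submodule.disjoint_def.1 hW.disjoint c
        (LinearMap.mem_ker.2 <| funext fun x => hzero x.2) c.2
  refine ⟨C, fun c => ?_⟩
  obtain ⟨z, hz, w, hw, rfl⟩ := Submodule.mem_sup.1 (hW.sup_eq_top ▸ Submodule.mem_top : c ∈ _ ⊔ W)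
  have hzw : Set.EqOn (T (z + w)) (T w) U := fun x hx => by
    have hzx : T z x = 0 := congrFun (LinearMap.mem_ker.1 hz) ⟨x, hx⟩
    rw [map_add, Pi.add_apply, hzx, zero_add]
  refine ⟨w, hzw, (hC ⟨w, hw⟩).trans_eq ?_⟩
  congr 1
  exact (eLpNorm_congr_ae ((ae_restrict_iff' hU.measurableSet).2
    (Filter.Eventually.of_forall hzw))).symm

end CoefficientBound

/-! ### Dyadic cubes and differences of arbitrary functions -/

section Geometry

variable {n l k : ℕ} {m : Fin n → ℤ} {r : ℝ≥0∞}

theorem mem_dyadicCube {x : Fin n → ℝ} :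
    x ∈ dyadicCube k m ↔ ∀ i, (m i : ℝ) < 2 ^ k * x i ∧ 2 ^ k * x i < m i + 1 := by
  have h2 : (0 : ℝ) < 2 ^ k := by positivity
  simp only [dyadicCube, openCube, corner, Set.mem_univ_pi, Set.mem_Ioo]
  refine forall_congr' fun i => ?_
  rw [div_lt_iff₀' h2, ← one_div, ← add_div, lt_div_iff₀' h2]

theorem measurableSet_dyadicCube (k : ℕ) (m : Fin n → ℤ) : MeasurableSet (dyadicCube k m) :=
  MeasurableSet.univ_pi fun _ => measurableSet_Ioo

theorem ae_exists_mem_dyadicCube (k : ℕ) :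
    ∀ᵐ x : Fin n → ℝ, x ∈ dyadicCube k fun i => ⌊2 ^ k * x i⌋ := by
  have hgrid : ∀ᵐ x : Fin n → ℝ, ∀ (i : Fin n) (z : ℤ), x i ≠ (z : ℝ) / 2 ^ k := by
    simp only [ae_all_iff]
    exact fun i z => compl_mem_ae_iff.2
      (Measure.pi_hyperplane (fun _ : Fin n => (volume : Measure ℝ)) i _)
  filter_upwards [hgrid] with x hx
  refine mem_dyadicCube.2 fun i => ⟨(Int.floor_le _).lt_of_ne fun he => hx i ⌊2 ^ k * x i⌋ ?_,
    Int.lt_floor_add_one _⟩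
  rw [he]; field_simp

/-- The open box concentric with the dyadic cube `Q_{k,m}`, enlarged by `l` side lengths in every
direction: it contains all points entering `δ^l_r(Q_{k,m})`. -/
def nearBox (l k : ℕ) (m : Fin n → ℤ) : Set (Fin n → ℝ) :=
  {x | ∀ i, (m i : ℝ) - l < 2 ^ k * x i ∧ 2 ^ k * x i < m i + l + 1}

theorem isOpen_nearBox (l k : ℕ) (m : Fin n → ℤ) : IsOpen (nearBox l k m) := by
  have heq : nearBox l k m = ⋂ i, {x : Fin n → ℝ | (m i : ℝ) - l < 2 ^ k * x i} ∩
      {x | 2 ^ k * x i < m i + l + 1} := by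
    ext x; simp [nearBox]
  rw [heq]
  exact isOpen_iInter_of_finite fun i => (isOpen_lt (by fun_prop) (by fun_prop)).inter
    (isOpen_lt (by fun_prop) (by fun_prop))

/-- The integer points with coordinates of absolute value at most `l`: the offsets of the dyadic
cubes that make up a `nearBox`. -/
noncomputable def shiftBox (n l : ℕ) : Finset (Fin n → ℤ) :=
  Fintype.piFinset fun _ => Finset.Icc (-(l : ℤ)) l

theorem mem_shiftBox {i : Fin n → ℤ} : i ∈ shiftBox n l ↔ ∀ c, |i c| ≤ l := by
  simp [shiftBox, abs_le]

theorem sub_mem_shiftBox {M : Fin n → ℤ} {x : Fin n → ℝ} (hx : x ∈ dyadicCube k M)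
    (hxm : x ∈ nearBox l k m) : M - m ∈ shiftBox n l := by
  refine mem_shiftBox.2 fun c => ?_
  have hM := mem_dyadicCube.1 hx c
  have hm := hxm c
  have hlow : m c - l < M c + 1 := by exact_mod_cast hm.1.trans hM.2
  have hup : M c < m c + l + 1 := by exact_mod_cast hM.1.trans hm.2
  rw [Pi.sub_apply, abs_le]
  omega

theorem exists_eLpNorm_nearBox_le (n : ℕ) (hr : r ≠ 0) (l : ℕ) :
    ∃ C : ℝ≥0, ∀ (k : ℕ) (m : Fin n → ℤ) (ψ : (Fin n → ℝ) → ℝ), AEStronglyMeasurable ψ volume →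
      eLpNorm ψ r (volume.restrict (nearBox l k m)) ≤
        C * ∑ i ∈ shiftBox n l, eLpNorm ψ r (volume.restrict (dyadicCube k (m + i))) := by
  obtain ⟨C, hC⟩ := exists_eLpNorm_le_mul_sum (X := Fin n → ℝ) (ε := ℝ) (ε' := ℝ) hr (shiftBox n l)
  refine ⟨C, fun k m ψ hψ => ?_⟩
  simp only [← eLpNorm_indicator_eq_eLpNorm_restrict (measurableSet_dyadicCube k _),
    ← eLpNorm_indicator_eq_eLpNorm_restrict (isOpen_nearBox l k m).measurableSet]
  refine hC _ _ _ (fun i _ => hψ.indicator (measurableSet_dyadicCube k _)) ?_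
  filter_upwards [ae_exists_mem_dyadicCube k] with x hx
  by_cases hxm : x ∈ nearBox l k m
  · rw [Set.indicator_of_mem hxm]
    refine le_trans (le_of_eq ?_) (Finset.single_le_sum
      (f := fun i => ‖(dyadicCube k (m + i)).indicator ψ x‖ₑ) (fun _ _ => zero_le)
      (sub_mem_shiftBox hx hxm))
    simp only [add_sub_cancel]
    rw [Set.indicator_of_mem hx]
  · simp [Set.indicator_of_notMem hxm]

end Geometry

section Delta

variable {n l k : ℕ} {m : Fin n → ℤ} {r : ℝ≥0∞}

theorem ofReal_two_pow_inv (k : ℕ) : ENNReal.ofReal ((2 ^ k : ℝ)⁻¹) = (2 : ℝ≥0∞) ^ (-(k : ℝ)) := by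
  rw [ENNReal.ofReal_inv_of_pos (by positivity), ENNReal.ofReal_pow (by norm_num),
    ENNReal.rpow_neg, ENNReal.rpow_natCast]
  norm_num

theorem two_rpow_add (x y : ℝ) : (2 : ℝ≥0∞) ^ (x + y) = 2 ^ x * 2 ^ y :=
  ENNReal.rpow_add _ _ (by norm_num) (by norm_num)

/-- The cube `2^{-k} I^n`, `I^n = (-1, 1)^n`, over which the step `h` ranges in `δ^l_r(Q_{k,m})`. -/
def stepCube (n k : ℕ) : Set (Fin n → ℝ) :=
  Set.univ.pi fun _ => Set.Ioo (-(2 ^ k : ℝ)⁻¹) (2 ^ k : ℝ)⁻¹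

theorem mem_stepCube {h : Fin n → ℝ} : h ∈ stepCube n k ↔ ∀ i, |2 ^ k * h i| < 1 := by
  have h2 : (0 : ℝ) < 2 ^ k := by positivity
  simp only [stepCube, Set.mem_univ_pi, Set.mem_Ioo, ← abs_lt, abs_mul, abs_of_pos h2,
    ← lt_div_iff₀' h2, one_div]

theorem measurableSet_stepCube (n k : ℕ) : MeasurableSet (stepCube n k) :=
  MeasurableSet.univ_pi fun _ => measurableSet_Ioo

theorem norm_two_pow_smul_le_one {h : Fin n → ℝ} (hh : h ∈ stepCube n k) :
    ‖(2 : ℝ) ^ k • h‖ ≤ 1 :=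
  (pi_norm_le_iff_of_nonneg zero_le_one).2 fun i => (mem_stepCube.1 hh i).le

theorem volume_stepCube (n k : ℕ) :
    volume (stepCube n k) = (2 : ℝ≥0∞) ^ ((1 - (k : ℝ)) * n) := by
  rw [stepCube, Real.volume_pi_Ioo, Finset.prod_const, Finset.card_univ, Fintype.card_fin,
    sub_neg_eq_add, ← two_mul, ENNReal.ofReal_mul (by norm_num), ofReal_two_pow_inv,
    ENNReal.rpow_mul, ENNReal.rpow_natCast, sub_eq_add_neg, two_rpow_add]
  norm_num

theorem volume_dyadicCube (k : ℕ) (m : Fin n → ℤ) :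
    volume (dyadicCube k m) = (2 : ℝ≥0∞) ^ (-(k : ℝ) * n) := by
  rw [dyadicCube, openCube, Real.volume_pi_Ioo]
  simp only [add_sub_cancel_left]
  rw [Finset.prod_const, Finset.card_univ, Fintype.card_fin, ofReal_two_pow_inv, ENNReal.rpow_mul,
    ENNReal.rpow_natCast]

/-- The measure on pairs (step, point) underlying `δ^l_r(Q_{k,m})`. -/
noncomputable def deltaMeasure (k : ℕ) (m : Fin n → ℤ) : Measure ((Fin n → ℝ) × (Fin n → ℝ)) :=
  (volume.restrict (stepCube n k)).prod (volume.restrict (dyadicCube k m))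

theorem delta_eq (l k : ℕ) (r : ℝ≥0∞) (m : Fin n → ℤ) (f : (Fin n → ℝ) → ℝ) :
    delta l r (corner k m) ((2 ^ k : ℝ)⁻¹) f = (2 : ℝ≥0∞) ^ (2 * (k : ℝ) * n / r.toReal) *
      eLpNorm (fun q : (Fin n → ℝ) × (Fin n → ℝ) => (fwdDiff q.1)^[l] f q.2) r
        (deltaMeasure k m) := by
  rw [delta, ofReal_two_pow_inv, ← ENNReal.rpow_mul]
  congr 2
  ring

theorem ae_deltaMeasure (k : ℕ) (m : Fin n → ℤ) :
    ∀ᵐ q ∂deltaMeasure k m, q.1 ∈ stepCube n k ∧ q.2 ∈ dyadicCube k m := by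
  rw [deltaMeasure, Measure.prod_restrict]
  exact ae_restrict_mem ((measurableSet_stepCube n k).prod (measurableSet_dyadicCube k m))

theorem delta_le_of_bound {f : (Fin n → ℝ) → ℝ} {B : ℝ≥0∞}
    (hB : ∀ h ∈ stepCube n k, ∀ x ∈ dyadicCube k m, ‖(fwdDiff h)^[l] f x‖ₑ ≤ B) :
    delta l r (corner k m) ((2 ^ k : ℝ)⁻¹) f ≤ (2 : ℝ≥0∞) ^ ((n : ℝ) / r.toReal) * B := by
  have hvol : deltaMeasure k m Set.univ = (2 : ℝ≥0∞) ^ ((1 - 2 * (k : ℝ)) * n) := by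
    rw [deltaMeasure, Measure.prod_restrict, Measure.restrict_apply_univ, Measure.prod_prod,
      volume_stepCube, volume_dyadicCube, ← two_rpow_add]
    congr 1
    ring
  have hnorm := eLpNorm_le_of_ae_enorm_bound (p := r)
    (f := fun q : (Fin n → ℝ) × (Fin n → ℝ) => (fwdDiff q.1)^[l] f q.2)
    ((ae_deltaMeasure k m).mono fun q hq => hB q.1 hq.1 q.2 hq.2)
  rw [delta_eq]
  refine (mul_le_mul_right hnorm _).trans_eq ?_
  rw [hvol, ← ENNReal.rpow_mul, smul_eq_mul, mul_left_comm, ← two_rpow_add, mul_comm]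
  congr 2
  ring

theorem add_nsmul_mem_nearBox {h x : Fin n → ℝ} (hh : h ∈ stepCube n k) (hx : x ∈ dyadicCube k m)
    {j : ℕ} (hj : j ≤ l) : x + j • h ∈ nearBox l k m := by
  intro i
  have hstep : |(j : ℝ) * (2 ^ k * h i)| ≤ l :=
    calc |(j : ℝ) * (2 ^ k * h i)| = j * |2 ^ k * h i| := by rw [abs_mul, Nat.abs_cast]
      _ ≤ l * 1 := by gcongr; exact (mem_stepCube.1 hh i).le
      _ = l := mul_one _
  have hcube := mem_dyadicCube.1 hx i
  have habs := abs_le.1 hstep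
  have hval : 2 ^ k * (x + j • h) i = 2 ^ k * x i + j * (2 ^ k * h i) := by
    have hi : (x + j • h) i = x i + j * h i := by simp
    rw [hi]
    ring
  rw [hval]
  constructor <;> linarith

theorem map_shift_deltaMeasure_le (m : Fin n → ℤ) {j : ℕ} (hj : j ≤ l) :
    Measure.map (fun q : (Fin n → ℝ) × (Fin n → ℝ) => q.2 + j • q.1) (deltaMeasure k m) ≤
      (2 : ℝ≥0∞) ^ ((1 - (k : ℝ)) * n) • volume.restrict (nearBox l k m) := by
  have hT : Measurable (fun q : (Fin n → ℝ) × (Fin n → ℝ) => q.2 + j • q.1) := by fun_prop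
  refine Measure.le_iff.2 fun A hA => ?_
  rw [Measure.map_apply hT hA, deltaMeasure, Measure.prod_apply (hT hA)]
  have hsection : ∀ h ∈ stepCube n k, (volume.restrict (dyadicCube k m))
      (Prod.mk h ⁻¹' ((fun q : (Fin n → ℝ) × (Fin n → ℝ) => q.2 + j • q.1) ⁻¹' A)) ≤
      volume.restrict (nearBox l k m) A := fun h hh => by
    rw [Measure.restrict_apply hA, Measure.restrict_apply (measurable_prodMk_left (hT hA)),
      ← measure_preimage_add_right volume (j • h) (A ∩ nearBox l k m)]
    exact measure_mono fun x hx => ⟨hx.1, add_nsmul_mem_nearBox hh hx.2 hj⟩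
  calc _ ≤ ∫⁻ _ in stepCube n k, volume.restrict (nearBox l k m) A :=
        setLIntegral_mono' (measurableSet_stepCube n k) hsection
    _ = _ := by rw [setLIntegral_const, volume_stepCube, mul_comm]; rfl

theorem aestronglyMeasurable_shift (m : Fin n → ℤ) (j : ℕ) {ψ : (Fin n → ℝ) → ℝ}
    (hψ : AEStronglyMeasurable ψ volume) :
    AEStronglyMeasurable (fun q : (Fin n → ℝ) × (Fin n → ℝ) => ψ (q.2 + j • q.1))
      (deltaMeasure k m) :=
  ((hψ.restrict (s := nearBox j k m)).smul_measure _).mono_measure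
    (map_shift_deltaMeasure_le m le_rfl) |>.comp_measurable (by fun_prop)

theorem aestronglyMeasurable_fwdDiff_iter (m : Fin n → ℤ) (l : ℕ) {ψ : (Fin n → ℝ) → ℝ}
    (hψ : AEStronglyMeasurable ψ volume) :
    AEStronglyMeasurable (fun q : (Fin n → ℝ) × (Fin n → ℝ) => (fwdDiff q.1)^[l] ψ q.2)
      (deltaMeasure k m) := by
  simp only [fwdDiff_iter_eq_sum_shift, zsmul_eq_mul]
  exact Finset.aestronglyMeasurable_fun_sum _ fun j _ =>
    (aestronglyMeasurable_shift m j hψ).const_mul _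

theorem eLpNorm_shift_le (m : Fin n → ℤ) {j : ℕ} (hj : j ≤ l) {ψ : (Fin n → ℝ) → ℝ}
    (hψ : AEStronglyMeasurable ψ volume) :
    eLpNorm (fun q : (Fin n → ℝ) × (Fin n → ℝ) => ψ (q.2 + j • q.1)) r (deltaMeasure k m) ≤
      (2 : ℝ≥0∞) ^ ((1 - (k : ℝ)) * n / r.toReal) *
        eLpNorm ψ r (volume.restrict (nearBox l k m)) := by
  have hmap := map_shift_deltaMeasure_le (k := k) m hj
  have hac := ((hψ.restrict (s := nearBox l k m)).smul_measure _).mono_measure hmap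
  calc _ = _ := (eLpNorm_map_measure (p := r) hac (by fun_prop)).symm
    _ ≤ _ := eLpNorm_mono_measure _ hmap
    _ ≤ _ := eLpNorm_smul_measure_le _ _ _ _
    _ = _ := by rw [smul_eq_mul, ← ENNReal.rpow_mul, one_div, ENNReal.toReal_inv, ← div_eq_mul_inv]

/-- The normalized `L_r` size `2^{kn/r} ‖ψ | L_r‖` on `nearBox l k m`, the local quantity that
controls `δ^l_r(Q_{k,m})`. -/
noncomputable def nearNorm (l : ℕ) (r : ℝ≥0∞) (k : ℕ) (m : Fin n → ℤ) (ψ : (Fin n → ℝ) → ℝ) :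
    ℝ≥0∞ :=
  scale n k r * eLpNorm ψ r (volume.restrict (nearBox l k m))

theorem scaled_eLpNorm_shift_le (m : Fin n → ℤ) {j : ℕ} (hj : j ≤ l) {ψ : (Fin n → ℝ) → ℝ}
    (hψ : AEStronglyMeasurable ψ volume) (a : ℕ) :
    (2 : ℝ≥0∞) ^ (2 * (k : ℝ) * n / r.toReal) *
      eLpNorm (fun q : (Fin n → ℝ) × (Fin n → ℝ) => a * ψ (q.2 + j • q.1)) r (deltaMeasure k m) ≤
      a * (2 ^ ((n : ℝ) / r.toReal) * nearNorm l r k m ψ) := by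
  have hscale : (2 : ℝ≥0∞) ^ (2 * (k : ℝ) * n / r.toReal) * 2 ^ ((1 - (k : ℝ)) * n / r.toReal) =
      2 ^ ((n : ℝ) / r.toReal) * scale n k r := by
    rw [scale, ← two_rpow_add, ← two_rpow_add]
    congr 1
    ring
  have hconst : eLpNorm (fun q : (Fin n → ℝ) × (Fin n → ℝ) => a * ψ (q.2 + j • q.1)) r
      (deltaMeasure k m) = a * eLpNorm (fun q : (Fin n → ℝ) × (Fin n → ℝ) => ψ (q.2 + j • q.1)) r
        (deltaMeasure k m) := by
    rw [← Real.enorm_natCast]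
    exact eLpNorm_const_smul (a : ℝ) _ r (deltaMeasure k m)
  rw [hconst, mul_left_comm, nearNorm, ← mul_assoc (2 ^ _), ← hscale, mul_assoc (2 ^ _)]
  gcongr
  exact eLpNorm_shift_le m hj hψ

theorem exists_delta_le_mul_nearNorm (n : ℕ) (hr : r ≠ 0) (l : ℕ) :
    ∃ C : ℝ≥0, ∀ (k : ℕ) (m : Fin n → ℤ) (ψ : (Fin n → ℝ) → ℝ), AEStronglyMeasurable ψ volume →
      delta l r (corner k m) ((2 ^ k : ℝ)⁻¹) ψ ≤ C * nearNorm l r k m ψ := by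
  obtain ⟨C, hC⟩ := exists_eLpNorm_le_mul_sum (X := (Fin n → ℝ) × (Fin n → ℝ)) (ε := ℝ) (ε' := ℝ)
    hr (Finset.range (l + 1))
  refine ⟨C * 2 ^ l * 2 ^ ((n : ℝ) / r.toReal), fun k m ψ hψ => ?_⟩
  have hdiff := hC (fun q => (fwdDiff q.1)^[l] ψ q.2)
    (fun j q => l.choose j * ψ (q.2 + j • q.1)) (deltaMeasure k m)
    (fun j _ => (aestronglyMeasurable_shift m j hψ).const_mul _)
    (Filter.Eventually.of_forall fun q => enorm_fwdDiff_iter_le ψ q.1 q.2 l)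
  have hchoose : ∑ j ∈ Finset.range (l + 1), (l.choose j : ℝ≥0∞) = 2 ^ l := by
    exact_mod_cast Nat.sum_range_choose l
  rw [delta_eq]
  calc _ ≤ (2 : ℝ≥0∞) ^ (2 * (k : ℝ) * n / r.toReal) * (C * ∑ j ∈ Finset.range (l + 1),
        eLpNorm (fun q : (Fin n → ℝ) × (Fin n → ℝ) => l.choose j * ψ (q.2 + j • q.1)) r
          (deltaMeasure k m)) := by gcongr
    _ ≤ C * ∑ j ∈ Finset.range (l + 1),
        l.choose j * (2 ^ ((n : ℝ) / r.toReal) * nearNorm l r k m ψ) := by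
      rw [mul_left_comm, Finset.mul_sum]
      exact mul_le_mul_right (Finset.sum_le_sum fun j hj =>
        scaled_eLpNorm_shift_le m (Finset.mem_range_succ_iff.1 hj) hψ _) _
    _ = _ := by
      rw [← Finset.sum_mul, hchoose, ENNReal.coe_mul, ENNReal.coe_mul,
        ENNReal.coe_rpow_of_ne_zero two_ne_zero]
      push_cast
      ring

end Delta

/-! ### Functions that locally are combinations of B-splines -/

section FiniteFamily

variable {X : Type*} [NormedAddCommGroup X] [MeasurableSpace X] [BorelSpace X] {ν : Measure X}
  [ν.IsOpenPosMeasure] {ι : Type*} [Fintype ι] {F : ι → X → ℝ} {U : Set X} {r : ℝ≥0∞} {l : ℕ}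

theorem exists_enorm_fwdDiff_iter_le (hF : ∀ i, Continuous (F i))
    (hFl : ∀ i, LocDiffBound l (F i)) (hU : IsOpen U) (hr : r ≠ 0) (R : ℝ) :
    ∃ C : ℝ≥0, ∀ (G : X → ℝ) (c : ι → ℝ), Set.EqOn G (∑ i, c i • F i) U →
      ∀ h x : X, ‖h‖ ≤ 1 → ‖x‖ ≤ R → (∀ a ≤ l, x + a • h ∈ U) →
        ‖(fwdDiff h)^[l] G x‖ₑ ≤ C * ‖h‖ₑ ^ l * eLpNorm G r (ν.restrict U) := by
  obtain ⟨C, hC⟩ := exists_coeff_enorm_le_mul_eLpNorm (ν := ν) hF hU hr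
  choose K hK using fun i => hFl i R
  refine ⟨(∑ i, K i) * C, fun G c hG h x hh hx horbit => ?_⟩
  obtain ⟨c', hcc', hc'⟩ := hC c
  have hnorm : eLpNorm (∑ i, c i • F i) r (ν.restrict U) = eLpNorm G r (ν.restrict U) :=
    eLpNorm_congr_ae ((ae_restrict_iff' hU.measurableSet).2 (.of_forall fun y hy => (hG hy).symm))
  have hdiff : (fwdDiff h)^[l] G x = ∑ i, c' i * (fwdDiff h)^[l] (F i) x := by
    rw [fwdDiff_iter_congr fun a ha => (hG.trans hcc') (horbit a ha), fwdDiff_iter_finsetSum,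
      Finset.sum_apply]
    simp only [fwdDiff_iter_const_smul, Pi.smul_apply, smul_eq_mul]
  have hterm (i : ι) : ‖(fwdDiff h)^[l] (F i) x‖ₑ ≤ K i * ‖h‖ₑ ^ l := by
    have hreal := ENNReal.ofReal_le_ofReal (hK i l le_rfl h x hh hx)
    rwa [← Real.enorm_eq_ofReal_abs, ENNReal.ofReal_mul (K i).coe_nonneg, ENNReal.ofReal_coe_nnreal,
      ENNReal.ofReal_pow (norm_nonneg h), ofReal_norm] at hreal
  rw [hdiff]
  calc _ ≤ ∑ i, ‖c' i * (fwdDiff h)^[l] (F i) x‖ₑ := enorm_sum_le _ _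
    _ ≤ ∑ i, C * eLpNorm G r (ν.restrict U) * (K i * ‖h‖ₑ ^ l) := by
      gcongr with i
      rw [enorm_mul]
      exact mul_le_mul' ((enorm_le_iff_norm_le.2 (norm_le_pi_norm c' i)).trans (hnorm ▸ hc'))
        (hterm i)
    _ = _ := by
      rw [← Finset.mul_sum, ← Finset.sum_mul]
      push_cast
      ring

end FiniteFamily

section LocalExpansion

variable {n l j k : ℕ} {m M : Fin n → ℤ} {r : ℝ≥0∞} {f g : (Fin n → ℝ) → ℝ}

/-- The translates of the cardinal spline (first index `0`) and of its dilate by `2` (first index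
`1`). With both generations, splines of level `j - 1` and of level `j` look alike at scale
`2 ^ (-j)`. -/
noncomputable def splineFamily (l : ℕ) (i : Fin 2 × (Fin n → ℤ)) (y : Fin n → ℝ) : ℝ :=
  cardSpline l (((2 : ℝ) ^ (i.1 : ℕ))⁻¹ • (y - fun c => (i.2 c : ℝ)))

theorem continuous_splineFamily (hl : 1 ≤ l) (i : Fin 2 × (Fin n → ℤ)) :
    Continuous (splineFamily l i) :=
  (continuous_cardSpline hl).comp (by fun_prop)

theorem locDiffBound_splineFamily (hl : 1 ≤ l) (i : Fin 2 × (Fin n → ℤ)) :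
    LocDiffBound l (splineFamily l i) := by
  have hdil : ‖((2 : ℝ) ^ (i.1 : ℕ))⁻¹‖ ≤ 1 := by
    rw [norm_inv, norm_pow, Real.norm_two]
    exact inv_le_one_of_one_le₀ (one_le_pow₀ one_le_two)
  have hle (z : Fin n → ℝ) : ‖((2 : ℝ) ^ (i.1 : ℕ))⁻¹ • z‖ ≤ ‖z‖ := by
    rw [norm_smul]
    exact mul_le_of_le_one_left (norm_nonneg z) hdil
  exact (locDiffBound_cardSpline hl).comp_affine (B := fun h => ((2 : ℝ) ^ (i.1 : ℕ))⁻¹ • h)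
    (fun x h => by rw [add_sub_right_comm, smul_add]) hle
    (fun x => (hle _).trans (norm_sub_le x _))

/-- The second indices for which `splineFamily` does not vanish identically on `nearBox l 0 0`. -/
noncomputable def splineIndex (n l : ℕ) : Finset (Fin n → ℤ) :=
  Fintype.piFinset fun _ => Finset.Icc (-(3 * l + 2 : ℤ)) (l + 1)

theorem splineFamily_eq_zero (a : Fin 2) {i : Fin n → ℤ} (hi : i ∉ splineIndex n l)
    {y : Fin n → ℝ} (hy : y ∈ nearBox l 0 0) : splineFamily l (a, i) y = 0 := by
  simp only [splineIndex, Fintype.mem_piFinset, not_forall, Finset.mem_Icc, not_and_or,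
    not_le] at hi
  obtain ⟨c, hc⟩ := hi
  have hyc := hy c
  simp only [Pi.zero_apply, Int.cast_zero, pow_zero, one_mul, zero_sub, zero_add] at hyc
  refine cardSpline_eq_zero c ?_
  rw [Pi.smul_apply, smul_eq_mul, le_inv_mul_iff₀ (by positivity)]
  rcases hc with hc | hc
  · right
    have hdil : (2 : ℝ) ^ (a : ℕ) ≤ 2 :=
      (pow_le_pow_right₀ one_le_two (Nat.le_of_lt_succ a.2)).trans_eq (pow_one 2)
    have hic : (i c : ℝ) + 1 ≤ -(3 * l + 2) := by exact_mod_cast hc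
    calc (2 : ℝ) ^ (a : ℕ) * (l + 1) ≤ 2 * (l + 1) := by gcongr
      _ ≤ y c - i c := by linarith
  · left
    have hic : (l : ℝ) + 1 < i c := by exact_mod_cast hc
    exact mul_neg_of_pos_of_neg (by positivity) (by simp only [Pi.sub_apply]; linarith)

/-- The affine map taking the unit cube to the dyadic cube `Q_{j,M}`. -/
noncomputable def cubeMap (j : ℕ) (M : Fin n → ℤ) (y : Fin n → ℝ) : Fin n → ℝ :=
  ((2 : ℝ) ^ j)⁻¹ • (y + fun c => (M c : ℝ))

theorem cubeMap_sub (j : ℕ) (M : Fin n → ℤ) (x : Fin n → ℝ) :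
    cubeMap j M ((2 : ℝ) ^ j • x - fun c => (M c : ℝ)) = x := by
  rw [cubeMap, sub_add_cancel, inv_smul_smul₀ (by positivity)]

theorem continuous_cubeMap (j : ℕ) (M : Fin n → ℤ) : Continuous (cubeMap j M) := by
  unfold cubeMap
  fun_prop

theorem cubeMap_mem_nearBox {y : Fin n → ℝ} :
    cubeMap j M y ∈ nearBox l j M ↔ y ∈ nearBox l 0 (0 : Fin n → ℤ) := by
  refine forall_congr' fun i => ?_
  have hval : (2 : ℝ) ^ j * cubeMap j M y i = y i + M i :=
    congrFun (smul_inv_smul₀ (by positivity : (2 : ℝ) ^ j ≠ 0) (y + fun c => (M c : ℝ))) i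
  rw [hval]
  simp only [Pi.zero_apply, Int.cast_zero, pow_zero, one_mul, zero_sub, zero_add]
  constructor <;> rintro ⟨hlow, hup⟩ <;> constructor <;> linarith

theorem dyadicCube_eq_nearBox (k : ℕ) (m : Fin n → ℤ) : dyadicCube k m = nearBox 0 k m := by
  ext x
  simp only [mem_dyadicCube, nearBox, Nat.cast_zero, sub_zero, add_zero, Set.mem_ofPred_eq]

/-- Near each dyadic cube of level `j`, the rescaled function `g` is a combination of the
functions `splineFamily l i`. -/
def HasLocalExpansion (l j : ℕ) (g : (Fin n → ℝ) → ℝ) : Prop :=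
  ∀ M : Fin n → ℤ, ∃ c : Fin 2 × splineIndex n l → ℝ,
    Set.EqOn (fun y => g (cubeMap j M y)) (∑ i, c i • splineFamily l (i.1, i.2)) (nearBox l 0 0)

theorem HasLocalExpansion.sub (hf : HasLocalExpansion l j f) (hg : HasLocalExpansion l j g) :
    HasLocalExpansion l j (f - g) := fun M => by
  obtain ⟨a, ha⟩ := hf M
  obtain ⟨b, hb⟩ := hg M
  refine ⟨a - b, fun y hy => ?_⟩
  simp only [Pi.sub_apply, sub_smul, Finset.sum_sub_distrib, ← ha hy, ← hb hy]

theorem exists_expansion (a : Fin 2) {e : (Fin n → ℤ) → Fin n → ℤ}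
    (he : Function.Injective e) (β : (Fin n → ℤ) → ℝ) :
    ∃ c : Fin 2 × splineIndex n l → ℝ, Set.EqOn (fun y => ∑' m, β m * splineFamily l (a, e m) y)
      (∑ i, c i • splineFamily l (i.1, i.2)) (nearBox l 0 0) := by
  refine ⟨fun i => if i.1 = a then Function.extend e β 0 i.2 else 0, fun y hy => ?_⟩
  let φ (i : Fin n → ℤ) : ℝ := Function.extend e β 0 i * splineFamily l (a, i) y
  have hsupp : Function.support φ ⊆ Set.range e := fun i hi => by
    by_contra hmem
    exact hi (by simp [φ, Function.extend_apply' _ _ _ hmem])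
  calc ∑' m, β m * splineFamily l (a, e m) y = ∑' m, φ (e m) := by
        simp only [φ, he.extend_apply]
    _ = ∑' i, φ i := he.tsum_eq hsupp
    _ = ∑ i ∈ splineIndex n l, φ i :=
        tsum_eq_sum fun i hi => by simp only [φ, splineFamily_eq_zero a hi hy, mul_zero]
    _ = _ := by
      rw [← Finset.sum_coe_sort (splineIndex n l) φ, Finset.sum_apply, Fintype.sum_prod_type,
        Finset.sum_eq_single a (fun b _ hb => by simp [hb]) (by simp)]
      simp [φ]

theorem hasLocalExpansion_of_mem_splineSpace {S : (Fin n → ℝ) → ℝ} (hS : S ∈ splineSpace n l j)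
    (a : Fin 2) : HasLocalExpansion l (j + a) S := fun M => by
  obtain ⟨β, hβ⟩ := hS
  have hinj : Function.Injective fun m : Fin n → ℤ => (2 : ℤ) ^ (a : ℕ) • m - M :=
    (sub_left_injective (b := M)).comp (smul_right_injective _ (by positivity))
  obtain ⟨c, hc⟩ := exists_expansion (l := l) a hinj β
  refine ⟨c, fun y hy => ?_⟩
  rw [← hc hy]
  dsimp only
  rw [hβ]
  refine tsum_congr fun m => ?_
  simp only [tensorSpline, splineFamily, cardSpline, cubeMap]
  congr! 3 with i
  simp [pow_add]
  field_simp
  ring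

theorem HasLocalExpansion.continuous (hl : 1 ≤ l) (hg : HasLocalExpansion l j g) :
    Continuous g := by
  rw [continuous_iff_continuousAt]
  intro x
  set M : Fin n → ℤ := fun c => ⌊2 ^ j * x c⌋
  obtain ⟨c, hc⟩ := hg M
  have hx : x ∈ nearBox l j M := fun i => by
    have hl' : (1 : ℝ) ≤ l := by exact_mod_cast hl
    have hlow := Int.floor_le (2 ^ j * x i)
    have hup := Int.lt_floor_add_one (2 ^ j * x i)
    constructor <;> linarith
  have hcont : Continuous fun z : Fin n → ℝ => (∑ i, c i • splineFamily l (i.1, (i.2 : Fin n → ℤ)))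
      ((2 : ℝ) ^ j • z - fun c => (M c : ℝ)) := by
    rw [Finset.sum_fn]
    exact continuous_finsetSum _ fun i _ =>
      ((continuous_splineFamily hl _).comp (by fun_prop)).const_smul (c i)
  refine hcont.continuousAt.congr ?_
  filter_upwards [(isOpen_nearBox l j M).mem_nhds hx] with z hz
  refine (hc ?_).symm.trans (congrArg g (cubeMap_sub j M z))
  rwa [← cubeMap_mem_nearBox (j := j) (M := M), cubeMap_sub]

theorem map_cubeMap (j : ℕ) (M : Fin n → ℤ) : Measure.map (cubeMap j M) volume =
    (2 : ℝ≥0∞) ^ ((j : ℝ) * n) • (volume : Measure (Fin n → ℝ)) := by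
  have hcomp : cubeMap j M =
      (fun y => ((2 : ℝ) ^ j)⁻¹ • y) ∘ (fun y => y + fun c => (M c : ℝ)) := rfl
  rw [hcomp, ← Measure.map_map (by fun_prop) (by fun_prop), map_add_right_eq_self,
    Measure.map_addHaar_smul volume (by positivity)]
  congr 1
  rw [Module.finrank_fin_fun, inv_pow, inv_inv, abs_of_pos (by positivity),
    ENNReal.ofReal_pow (by positivity), ENNReal.ofReal_pow (by norm_num), ENNReal.rpow_mul,
    ENNReal.rpow_natCast, ENNReal.rpow_natCast]
  norm_num

theorem eLpNorm_comp_cubeMap (hg : Continuous g) (l j : ℕ) (r : ℝ≥0∞) (M : Fin n → ℤ) :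
    eLpNorm (fun y => g (cubeMap j M y)) r (volume.restrict (nearBox l 0 0)) =
      nearNorm l r j M g := by
  have hmeas := (continuous_cubeMap j M).measurable
  have hpre : nearBox l 0 (0 : Fin n → ℤ) = cubeMap j M ⁻¹' nearBox l j M :=
    Set.ext fun y => cubeMap_mem_nearBox.symm
  have hmap := eLpNorm_map_measure (p := r) (f := cubeMap j M)
    (μ := volume.restrict (nearBox l 0 (0 : Fin n → ℤ))) hg.aestronglyMeasurable hmeas.aemeasurable
  refine hmap.symm.trans ?_
  rw [hpre, ← Measure.restrict_map hmeas (isOpen_nearBox l j M).measurableSet, map_cubeMap,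
    Measure.restrict_smul, eLpNorm_smul_measure_of_ne_zero (by simp), smul_eq_mul, nearNorm, scale,
    ← ENNReal.rpow_mul, one_div, ENNReal.toReal_inv, div_eq_mul_inv]

theorem enorm_two_pow_smul_le {h : Fin n → ℝ} (hh : h ∈ stepCube n k) (j : ℕ) :
    ‖(2 : ℝ) ^ j • h‖ₑ ≤ (2 : ℝ≥0∞) ^ ((j : ℝ) - k) := by
  have hone : ‖(2 : ℝ) ^ k • h‖ₑ ≤ 1 := by
    rw [← enorm_one (G := ℝ), enorm_le_iff_norm_le, norm_one]
    exact norm_two_pow_smul_le_one hh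
  calc ‖(2 : ℝ) ^ j • h‖ₑ = ‖(2 : ℝ) ^ j * ((2 : ℝ) ^ k)⁻¹‖ₑ * ‖(2 : ℝ) ^ k • h‖ₑ := by
        rw [← enorm_smul, mul_smul, inv_smul_smul₀ (by positivity)]
    _ ≤ ‖(2 : ℝ) ^ j * ((2 : ℝ) ^ k)⁻¹‖ₑ * 1 := by gcongr
    _ = _ := by
      rw [mul_one, enorm_mul, enorm_inv (by positivity), enorm_pow, enorm_pow, sub_eq_add_neg,
        two_rpow_add, ENNReal.rpow_neg, ENNReal.rpow_natCast, ENNReal.rpow_natCast,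
        Real.enorm_eq_ofReal zero_le_two, ENNReal.ofReal_ofNat]

theorem two_pow_smul_mem_stepCube (hjk : j ≤ k) {h : Fin n → ℝ} (hh : h ∈ stepCube n k) :
    (2 : ℝ) ^ j • h ∈ stepCube n 0 := by
  refine mem_stepCube.2 fun i => lt_of_le_of_lt ?_ (mem_stepCube.1 hh i)
  rw [pow_zero, one_mul, Pi.smul_apply, smul_eq_mul, abs_mul, abs_mul]
  gcongr
  exact one_le_two

theorem exists_delta_le_of_hasLocalExpansion (n : ℕ) (hl : 1 ≤ l) (hr : r ≠ 0) :
    ∃ C : ℝ≥0, ∀ (j k : ℕ), j ≤ k → ∀ m M : Fin n → ℤ, dyadicCube k m ⊆ dyadicCube j M →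
      ∀ g : (Fin n → ℝ) → ℝ, HasLocalExpansion l j g →
      delta l r (corner k m) ((2 ^ k : ℝ)⁻¹) g ≤
        C * (2 : ℝ≥0∞) ^ ((l : ℝ) * ((j : ℝ) - k)) * nearNorm l r j M g := by
  obtain ⟨C, hC⟩ := exists_enorm_fwdDiff_iter_le (ν := volume)
    (F := fun i : Fin 2 × splineIndex n l => splineFamily l (i.1, (i.2 : Fin n → ℤ)))
    (fun _ => continuous_splineFamily hl _) (fun _ => locDiffBound_splineFamily hl _)
    (isOpen_nearBox l 0 0) hr 1
  refine ⟨2 ^ ((n : ℝ) / r.toReal) * C, fun j k hjk m M hsub g hg => ?_⟩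
  obtain ⟨c, hc⟩ := hg M
  have hbound : ∀ h ∈ stepCube n k, ∀ x ∈ dyadicCube k m, ‖(fwdDiff h)^[l] g x‖ₑ ≤
      C * (2 : ℝ≥0∞) ^ ((l : ℝ) * ((j : ℝ) - k)) * nearNorm l r j M g := fun h hh x hx => by
    set y : Fin n → ℝ := (2 : ℝ) ^ j • x - fun c => (M c : ℝ)
    have hy0 : y ∈ dyadicCube 0 0 := by
      rw [dyadicCube_eq_nearBox, ← cubeMap_mem_nearBox (j := j) (M := M), cubeMap_sub,
        ← dyadicCube_eq_nearBox]
      exact hsub hx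
    have hy1 : ‖y‖ ≤ 1 := (pi_norm_le_iff_of_nonneg zero_le_one).2 fun i => by
      have hyi := mem_dyadicCube.1 hy0 i
      simp only [Pi.zero_apply, Int.cast_zero, pow_zero, one_mul, zero_add] at hyi
      exact abs_le.2 ⟨by linarith, hyi.2.le⟩
    have hH := two_pow_smul_mem_stepCube hjk hh
    have hH1 : ‖(2 : ℝ) ^ j • h‖ ≤ 1 := by simpa using norm_two_pow_smul_le_one hH
    have hdiff := hC _ c hc _ y hH1 hy1 fun a ha => add_nsmul_mem_nearBox hH hy0 ha
    rw [fwdDiff_iter_comp_affine g (h' := h) fun z => by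
      rw [cubeMap, cubeMap, add_right_comm, smul_add, inv_smul_smul₀ (by positivity)], cubeMap_sub,
      eLpNorm_comp_cubeMap (hg.continuous hl)] at hdiff
    refine hdiff.trans ?_
    rw [mul_comm (l : ℝ), ENNReal.rpow_mul, ENNReal.rpow_natCast]
    gcongr
    exact enorm_two_pow_smul_le hh j
  refine (delta_le_of_bound hbound).trans_eq ?_
  rw [ENNReal.coe_mul, ENNReal.coe_rpow_of_ne_zero two_ne_zero, ENNReal.coe_ofNat]
  ring

end LocalExpansion

/-! ### Weights on dyadic cubes -/

section Fibres

variable {ι κ X : Type*} {p : ℝ≥0∞}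

theorem seqNorm_mul_comp_le_of_fibre (hp : p ≠ 0) (π : ι → κ) {w : ι → ℝ≥0∞} {v : κ → ℝ≥0∞}
    {D : ℝ≥0∞} (h : ∀ K, seqNorm p (fun i : {i // π i = K} => w i) ≤ D * v K) (b : κ → ℝ≥0∞) :
    seqNorm p (fun i => w i * b (π i)) ≤ D * seqNorm p (fun K => v K * b K) := by
  rw [← seqNorm_const_mul hp]
  unfold seqNorm at h ⊢
  split_ifs at h ⊢ with hp_top
  · refine iSup_le fun i => le_iSup_of_le (π i) ?_
    simp only [← mul_assoc]
    gcongr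
    exact (le_iSup (fun i' : {i' // π i' = π i} => w i') ⟨i, rfl⟩).trans (h _)
  · have hp' := ENNReal.toReal_pos hp hp_top
    refine ENNReal.rpow_le_rpow ?_ (by positivity)
    calc ∑' i, (w i * b (π i)) ^ p.toReal
        = ∑' (K) (i : {i // π i = K}), w i ^ p.toReal * b K ^ p.toReal := by
          rw [← (Equiv.sigmaFiberEquiv π).tsum_eq, ENNReal.tsum_sigma']
          refine tsum_congr fun K => tsum_congr ?_
          rintro ⟨i, rfl⟩
          exact ENNReal.mul_rpow_of_nonneg _ _ hp'.le
      _ ≤ ∑' K, (D * (v K * b K)) ^ p.toReal := by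
          refine ENNReal.tsum_le_tsum fun K => ?_
          rw [ENNReal.tsum_mul_right, ← mul_assoc, ENNReal.mul_rpow_of_nonneg _ _ hp'.le]
          gcongr
          simpa only [← ENNReal.rpow_mul, one_div_mul_cancel hp'.ne', ENNReal.rpow_one] using
            ENNReal.rpow_le_rpow (h K) hp'.le

theorem seqNorm_eLpNorm_restrict_le [Countable ι] [MeasurableSpace X] {ν : Measure X} (hp : p ≠ 0)
    {A : ι → Set X} {B : Set X} (hA : ∀ i, MeasurableSet (A i))
    (hdisj : Pairwise (Function.onFun Disjoint A)) (hAB : ∀ i, A i ⊆ B) (f : X → ℝ≥0∞) :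
    seqNorm p (fun i => eLpNorm f p (ν.restrict (A i))) ≤ eLpNorm f p (ν.restrict B) := by
  unfold seqNorm
  split_ifs with hp_top
  · exact iSup_le fun i => eLpNorm_mono_measure _ (Measure.restrict_mono (hAB i) le_rfl)
  · have hp' := ENNReal.toReal_pos hp hp_top
    simp only [eLpNorm_eq_lintegral_rpow_enorm_toReal hp hp_top, ← ENNReal.rpow_mul,
      one_div_mul_cancel hp'.ne', ENNReal.rpow_one]
    rw [← lintegral_iUnion hA hdisj]
    gcongr
    exact Set.iUnion_subset hAB

end Fibres

section CubeWeight

variable {n : ℕ} {p : ℝ≥0∞} {α₂ α₃ : ℝ} {c : ℝ≥0} {w : ℕ → (Fin n → ℤ) → ℝ≥0∞}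

/-- The index of the dyadic cube `d` levels above which contains the cube with index `m`. -/
def parent (d : ℕ) (m : Fin n → ℤ) : Fin n → ℤ := fun i => m i / 2 ^ d

/-- The weights `w k m` of the dyadic cubes `Q_{k,m}` for which the inverse estimate holds: the
`l_p` norm of the weights of the cubes of level `k` inside a cube of level `j ≤ k` exceeds the
weight of that cube at most by the factor `c 2^{α₂ (k - j)}`, and the weights of touching cubes of
the same level differ at most by the factor `2^{α₃}`. -/
structure IsCubeWeight (α₂ α₃ : ℝ) (c : ℝ≥0) (p : ℝ≥0∞) (w : ℕ → (Fin n → ℤ) → ℝ≥0∞) :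
    Prop where
  subdivide : ∀ {j k : ℕ}, j ≤ k → ∀ M, seqNorm p (fun m : {m // parent (k - j) m = M} => w k m) ≤
    c * (2 : ℝ≥0∞) ^ (α₂ * ((k : ℝ) - j)) * w j M
  neighbour : ∀ (k : ℕ) (m m' : Fin n → ℤ), (∀ i, |m i - m' i| ≤ 1) →
    w k m ≤ (2 : ℝ≥0∞) ^ α₃ * w k m'

theorem IsCubeWeight.seqNorm_parent_le (hw : IsCubeWeight α₂ α₃ c p w) (hp : p ≠ 0) {j k : ℕ}
    (hjk : j ≤ k) (b : (Fin n → ℤ) → ℝ≥0∞) :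
    seqNorm p (fun m => w k m * b (parent (k - j) m)) ≤
      c * (2 : ℝ≥0∞) ^ (α₂ * ((k : ℝ) - j)) * seqNorm p (fun M => w j M * b M) :=
  seqNorm_mul_comp_le_of_fibre hp _ (hw.subdivide hjk) b

theorem IsCubeWeight.le_shift (hw : IsCubeWeight α₂ α₃ c p w) (k a : ℕ) (m : Fin n → ℤ)
    {i : Fin n → ℤ} (hi : ∀ e, |i e| ≤ a) : w k m ≤ ((2 : ℝ≥0∞) ^ α₃) ^ a * w k (m + i) := by
  induction a generalizing i with
  | zero =>
    obtain rfl : i = 0 := funext fun e => by simpa using hi e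
    simp
  | succ a ih =>
    have step_toward_zero (z : ℤ) (hz : |z| ≤ (a + 1 : ℕ)) : ∃ y : ℤ, |y| ≤ a ∧ |y - z| ≤ 1 := by
      rcases lt_trichotomy z 0 with h | h | h
      · exact ⟨z + 1, by grind, by simp⟩
      · exact ⟨0, by simp, by simp [h]⟩
      · exact ⟨z - 1, by grind, by simp⟩
    choose y hya hyi using fun e => step_toward_zero (i e) (hi e)
    calc w k m ≤ ((2 : ℝ≥0∞) ^ α₃) ^ a * w k (m + y) := ih hya
      _ ≤ ((2 : ℝ≥0∞) ^ α₃) ^ a * ((2 : ℝ≥0∞) ^ α₃ * w k (m + i)) := by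
          gcongr
          exact hw.neighbour k _ _ fun e => by simpa using hyi e
      _ = _ := by rw [pow_succ, mul_assoc]

theorem IsCubeWeight.exists_seqNorm_le_of_shift (n l : ℕ) (α₂ α₃ : ℝ) (c : ℝ≥0) (hp : p ≠ 0) :
    ∃ C : ℝ≥0, ∀ w : ℕ → (Fin n → ℤ) → ℝ≥0∞, IsCubeWeight α₂ α₃ c p w →
      ∀ (k : ℕ) (F a : (Fin n → ℤ) → ℝ≥0∞), (∀ m, F m ≤ ∑ i ∈ shiftBox n l, a (m + i)) →
      seqNorm p (fun m => w k m * F m) ≤ C * seqNorm p (fun m => w k m * a m) := by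
  obtain ⟨C, hC⟩ := exists_seqNorm_sum_le (ι := Fin n → ℤ) hp (shiftBox n l)
  refine ⟨C * ((shiftBox n l).card * ((2 : ℝ≥0) ^ α₃) ^ l), fun w hw k F a hF => ?_⟩
  have hpoint (m : Fin n → ℤ) : w k m * F m ≤
      ∑ i ∈ shiftBox n l, ((2 : ℝ≥0∞) ^ α₃) ^ l * (w k (m + i) * a (m + i)) := by
    refine (mul_le_mul_right (hF m) _).trans ?_
    rw [Finset.mul_sum]
    refine Finset.sum_le_sum fun i hi => ?_
    rw [← mul_assoc]
    gcongr
    exact hw.le_shift k l m (mem_shiftBox.1 hi)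
  have hshift (i : Fin n → ℤ) : seqNorm p (fun m => w k (m + i) * a (m + i)) =
      seqNorm p (fun m => w k m * a m) :=
    seqNorm_comp_equiv (Equiv.addRight i) fun m => w k m * a m
  calc seqNorm p (fun m => w k m * F m)
      ≤ C * ∑ i ∈ shiftBox n l, seqNorm p
          (fun m => ((2 : ℝ≥0∞) ^ α₃) ^ l * (w k (m + i) * a (m + i))) :=
        (seqNorm_mono hp hpoint).trans (hC _)
    _ = _ := by
        simp only [seqNorm_const_mul hp, hshift, Finset.sum_const, nsmul_eq_mul]
        push_cast [ENNReal.coe_rpow_of_ne_zero (two_ne_zero (α := ℝ≥0))]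
        ring

end CubeWeight

section XClass

variable {n : ℕ} {α₁ α₂ α₃ : ℝ} {σ₁ p : ℝ≥0∞} {c₁ c₂ : ℝ} {t : ℕ → (Fin n → ℝ) → ℝ}

theorem dyadicCube_subset_parent {j k : ℕ} (hjk : j ≤ k) (m : Fin n → ℤ) :
    dyadicCube k m ⊆ dyadicCube j (parent (k - j) m) := by
  obtain ⟨d, rfl⟩ := Nat.exists_eq_add_of_le hjk
  rw [Nat.add_sub_cancel_left]
  intro x hx
  rw [mem_dyadicCube] at hx ⊢
  intro i
  have hd : (0 : ℝ) < 2 ^ d := by positivity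
  have hlower : (parent d m i : ℝ) * 2 ^ d ≤ m i := by
    exact_mod_cast Int.ediv_mul_le (m i) (by positivity : (2 ^ d : ℤ) ≠ 0)
  have hupper : (m i : ℝ) + 1 ≤ (parent d m i + 1) * 2 ^ d := by
    exact_mod_cast Int.lt_ediv_add_one_mul_self (m i) (by positivity : (0 : ℤ) < 2 ^ d)
  have hxi := hx i
  rw [pow_add] at hxi
  constructor <;> refine lt_of_mul_lt_mul_right ?_ hd.le <;> linarith

theorem eq_floor_of_mem_dyadicCube {k : ℕ} {m : Fin n → ℤ} {x : Fin n → ℝ}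
    (hx : x ∈ dyadicCube k m) : m = fun i => ⌊2 ^ k * x i⌋ := by
  funext i
  have := mem_dyadicCube.1 hx i
  exact (Int.floor_eq_iff.2 ⟨this.1.le, this.2⟩).symm

theorem disjoint_dyadicCube (k : ℕ) :
    Pairwise (Function.onFun Disjoint (dyadicCube (n := n) k)) := fun _ _ hne =>
  Set.disjoint_left.2 fun _ hx hx' =>
    hne ((eq_floor_of_mem_dyadicCube hx).trans (eq_floor_of_mem_dyadicCube hx').symm)

theorem mem_dyadicCubeHalfOpen_iff {k : ℕ} {m : Fin n → ℤ} {x : Fin n → ℝ} :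
    x ∈ dyadicCubeHalfOpen k m ↔ m = fun i => ⌊2 ^ k * x i⌋ := by
  have h2 : (0 : ℝ) < 2 ^ k := by positivity
  simp only [dyadicCubeHalfOpen, Set.mem_univ_pi, Set.mem_Ico, div_le_iff₀' h2, lt_div_iff₀' h2,
    funext_iff, eq_comm (a := m _), Int.floor_eq_iff]

theorem assocWeight_of_mem {k : ℕ} {m : Fin n → ℤ} {x : Fin n → ℝ} (hx : x ∈ dyadicCube k m) :
    assocWeight p t k x = scale n k p * assoc p t k m := by
  have hm := eq_floor_of_mem_dyadicCube hx
  rw [assocWeight, tsum_eq_single m fun m' hm' => Set.indicator_of_notMem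
      (fun h => hm' ((mem_dyadicCubeHalfOpen_iff.1 h).trans hm.symm)) _,
    Set.indicator_of_mem (mem_dyadicCubeHalfOpen_iff.2 hm)]

theorem scale_mul_volume_rpow (k : ℕ) (m : Fin n → ℤ) :
    scale n k p * volume (dyadicCube k m) ^ (1 / p.toReal) = 1 := by
  rw [volume_dyadicCube, scale, ← ENNReal.rpow_mul, ← two_rpow_add]
  convert ENNReal.rpow_zero using 2
  ring

theorem eLpNorm_assocWeight (hp : p ≠ 0) (k : ℕ) (m : Fin n → ℤ) :
    eLpNorm (assocWeight p t k) p (volume.restrict (dyadicCube k m)) = assoc p t k m := by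
  have hconst : assocWeight p t k =ᵐ[volume.restrict (dyadicCube k m)]
      fun _ => scale n k p * assoc p t k m :=
    (ae_restrict_mem (measurableSet_dyadicCube k m)).mono fun x hx => assocWeight_of_mem hx
  have hne : volume.restrict (dyadicCube k m) ≠ 0 := by
    rw [Ne, Measure.restrict_eq_zero, volume_dyadicCube]
    simp
  rw [eLpNorm_congr_ae hconst, eLpNorm_const _ hp hne, Measure.restrict_apply_univ,
    enorm_eq_self, mul_right_comm, scale_mul_volume_rpow, one_mul]

theorem seqNorm_assoc_descendants_le (hp : p ≠ 0) {j k : ℕ} (hjk : j ≤ k) (M : Fin n → ℤ) :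
    seqNorm p (fun m : {m // parent (k - j) m = M} => assoc p t k m) ≤
      eLpNorm (assocWeight p t k) p (volume.restrict (dyadicCube j M)) := by
  have hsub (m : {m // parent (k - j) m = M}) : dyadicCube k m.1 ⊆ dyadicCube j M := by
    obtain ⟨m, rfl⟩ := m
    exact dyadicCube_subset_parent hjk m
  have hdisj : Pairwise
      (Function.onFun Disjoint fun m : {m // parent (k - j) m = M} => dyadicCube k m.1) :=
    fun a b hab => disjoint_dyadicCube k (Subtype.coe_injective.ne hab)
  have hle := seqNorm_eLpNorm_restrict_le (ν := volume) hp
    (fun m => measurableSet_dyadicCube k _) hdisj hsub (assocWeight p t k)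
  simpa only [eLpNorm_assocWeight hp] using hle

theorem scale_ne_zero (k : ℕ) : scale n k p ≠ 0 := by simp [scale]

theorem scale_ne_top (k : ℕ) : scale n k p ≠ ∞ := by
  simp [scale, ENNReal.rpow_eq_top_iff]

theorem IsXClass.assoc_ne_top {σ₂ : ℝ≥0∞} (ht : IsXClass α₁ α₂ α₃ σ₁ σ₂ p c₁ c₂ t) (k : ℕ)
    (m : Fin n → ℤ) : assoc p t k m ≠ ∞ := by
  have hK : IsCompact (Set.univ.pi fun i : Fin n =>
      Set.Icc (corner k m i) (corner k m i + (2 ^ k : ℝ)⁻¹)) :=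
    isCompact_univ_pi fun _ => isCompact_Icc
  refine ne_top_of_le_ne_top (ht.admissible k _ hK).eLpNorm_lt_top.ne
    (eLpNorm_mono_measure _ (Measure.restrict_mono ?_ le_rfl))
  exact Set.pi_mono fun i _ => Set.Ioo_subset_Icc_self

theorem IsXClass.isCubeWeight (ht : IsXClass α₁ α₂ α₃ σ₁ p p c₁ c₂ t) (hp : p ≠ 0) :
    IsCubeWeight α₂ α₃ c₂.toNNReal p (assoc p t) where
  subdivide {j k} hjk M := by
    have hupper := ht.upper j k M hjk
    simp only [cubeMean, eLpNorm_assocWeight hp] at hupper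
    rw [ENNReal.mul_inv (Or.inl (scale_ne_zero j)) (Or.inl (scale_ne_top j)), mul_mul_mul_comm,
      ENNReal.inv_mul_cancel (scale_ne_zero j) (scale_ne_top j), one_mul, mul_comm,
      ← div_eq_mul_inv, ENNReal.div_le_iff (ht.assoc_pos j M).ne' (ht.assoc_ne_top j M)] at hupper
    exact (seqNorm_assoc_descendants_le hp hjk M).trans hupper
  neighbour := ht.neighbour

end XClass

/-! ### The inverse estimate -/

section LevelNorm

variable {n l : ℕ} {p r : ℝ≥0∞} {α₂ α₃ : ℝ} {c : ℝ≥0} {w : ℕ → (Fin n → ℤ) → ℝ≥0∞}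

/-- The weighted norm `(∑_m w_{k,m}^p (2^{kn/r} ‖ψ | L_r(Q_{k,m})‖)^p)^{1/p}` of level `k`. -/
noncomputable def levelNorm (r p : ℝ≥0∞) (w : ℕ → (Fin n → ℤ) → ℝ≥0∞) (k : ℕ)
    (ψ : (Fin n → ℝ) → ℝ) : ℝ≥0∞ :=
  seqNorm p fun m => w k m * (scale n k r * eLpNorm ψ r (volume.restrict (dyadicCube k m)))

/-- The weighted norm `(∑_m w_{k,m}^p [δ^l_r(Q_{k,m})ψ]^p)^{1/p}` of the local moduli of smoothness
of level `k`. -/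
noncomputable def diffNorm (l : ℕ) (r p : ℝ≥0∞) (w : ℕ → (Fin n → ℤ) → ℝ≥0∞) (k : ℕ)
    (ψ : (Fin n → ℝ) → ℝ) : ℝ≥0∞ :=
  seqNorm p fun m => w k m * delta l r (corner k m) ((2 ^ k : ℝ)⁻¹) ψ

/-- The best approximation `s_k^{l+1}(φ)`, by splines of order `l + 1` and hence of degree `l`. -/
noncomputable def bestApprox (l : ℕ) (r p : ℝ≥0∞) (w : ℕ → (Fin n → ℤ) → ℝ≥0∞)
    (φ : (Fin n → ℝ) → ℝ) (k : ℕ) : ℝ≥0∞ :=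
  ⨅ S ∈ splineSpace n l k, levelNorm r p w k (φ - S)

theorem exists_seqNorm_nearNorm_le (n l : ℕ) (hp : p ≠ 0) (hr : r ≠ 0) (α₂ α₃ : ℝ) (c : ℝ≥0) :
    ∃ C : ℝ≥0, ∀ w : ℕ → (Fin n → ℤ) → ℝ≥0∞, IsCubeWeight α₂ α₃ c p w →
      ∀ ψ, AEStronglyMeasurable ψ volume → ∀ k,
      seqNorm p (fun m => w k m * nearNorm l r k m ψ) ≤ C * levelNorm r p w k ψ := by
  obtain ⟨C, hC⟩ := exists_eLpNorm_nearBox_le n hr l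
  obtain ⟨D, hD⟩ := IsCubeWeight.exists_seqNorm_le_of_shift n l α₂ α₃ c hp
  refine ⟨D * C, fun w hw ψ hψ k => ?_⟩
  have hnear (m : Fin n → ℤ) : nearNorm l r k m ψ ≤ ∑ i ∈ shiftBox n l,
      C * (scale n k r * eLpNorm ψ r (volume.restrict (dyadicCube k (m + i)))) := by
    rw [← Finset.mul_sum, ← Finset.mul_sum, mul_left_comm, nearNorm]
    gcongr
    exact hC k m ψ hψ
  refine (hD w hw k _ (fun m => C * (scale n k r * eLpNorm ψ r (volume.restrict (dyadicCube k m))))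
    hnear).trans_eq ?_
  simp only [mul_left_comm _ (C : ℝ≥0∞)]
  rw [seqNorm_const_mul hp, levelNorm, ENNReal.coe_mul, mul_assoc]

theorem exists_diffNorm_le_levelNorm (n l : ℕ) (hp : p ≠ 0) (hr : r ≠ 0) (α₂ α₃ : ℝ) (c : ℝ≥0) :
    ∃ C : ℝ≥0, ∀ w : ℕ → (Fin n → ℤ) → ℝ≥0∞, IsCubeWeight α₂ α₃ c p w →
      ∀ ψ, AEStronglyMeasurable ψ volume → ∀ k,
      diffNorm l r p w k ψ ≤ C * levelNorm r p w k ψ := by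
  obtain ⟨C, hC⟩ := exists_delta_le_mul_nearNorm n hr l
  obtain ⟨D, hD⟩ := exists_seqNorm_nearNorm_le n l hp hr α₂ α₃ c
  refine ⟨C * D, fun w hw ψ hψ k => ?_⟩
  calc diffNorm l r p w k ψ ≤ seqNorm p (fun m => C * (w k m * nearNorm l r k m ψ)) :=
        seqNorm_mono hp fun m => by rw [mul_left_comm]; gcongr; exact hC k m ψ hψ
    _ = C * seqNorm p (fun m => w k m * nearNorm l r k m ψ) := seqNorm_const_mul hp _ _
    _ ≤ C * (D * levelNorm r p w k ψ) := by gcongr; exact hD w hw ψ hψ k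
    _ = _ := by rw [ENNReal.coe_mul, mul_assoc]

theorem exists_diffNorm_le_of_hasLocalExpansion (n : ℕ) (hl : 1 ≤ l) (hp : p ≠ 0) (hr : r ≠ 0)
    (α₂ α₃ : ℝ) (c : ℝ≥0) :
    ∃ C : ℝ≥0, ∀ w : ℕ → (Fin n → ℤ) → ℝ≥0∞, IsCubeWeight α₂ α₃ c p w →
      ∀ {j k : ℕ}, j ≤ k → ∀ g, HasLocalExpansion l j g →
      diffNorm l r p w k g ≤ C * (2 : ℝ≥0∞) ^ (((j : ℝ) - k) * (l - α₂)) * levelNorm r p w j g := by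
  obtain ⟨C, hC⟩ := exists_delta_le_of_hasLocalExpansion n hl hr
  obtain ⟨D, hD⟩ := exists_seqNorm_nearNorm_le n l hp hr α₂ α₃ c
  refine ⟨C * c * D, fun w hw j k hjk g hg => ?_⟩
  have hexp : ((j : ℝ) - k) * (l - α₂) = (l : ℝ) * ((j : ℝ) - k) + α₂ * ((k : ℝ) - j) := by ring
  calc diffNorm l r p w k g
      ≤ seqNorm p (fun m => C * (2 : ℝ≥0∞) ^ ((l : ℝ) * ((j : ℝ) - k)) *
          (w k m * nearNorm l r j (parent (k - j) m) g)) :=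
        seqNorm_mono hp fun m => by
          rw [mul_left_comm]
          gcongr
          exact hC j k hjk m _ (dyadicCube_subset_parent hjk m) g hg
    _ ≤ C * (2 : ℝ≥0∞) ^ ((l : ℝ) * ((j : ℝ) - k)) * (c * (2 : ℝ≥0∞) ^ (α₂ * ((k : ℝ) - j)) *
          seqNorm p (fun M => w j M * nearNorm l r j M g)) := by
        rw [seqNorm_const_mul hp]
        gcongr
        exact hw.seqNorm_parent_le hp hjk fun M => nearNorm l r j M g
    _ ≤ C * (2 : ℝ≥0∞) ^ ((l : ℝ) * ((j : ℝ) - k)) * (c * (2 : ℝ≥0∞) ^ (α₂ * ((k : ℝ) - j)) *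
          (D * levelNorm r p w j g)) := by
        gcongr
        exact hD w hw g (hg.continuous hl).aestronglyMeasurable j
    _ = _ := by
        rw [hexp, two_rpow_add]
        push_cast
        ring

theorem IsCubeWeight.levelNorm_succ_le (hw : IsCubeWeight α₂ α₃ c p w) (hp : p ≠ 0) (j : ℕ)
    (ψ : (Fin n → ℝ) → ℝ) : levelNorm r p w (j + 1) ψ ≤
      c * (2 : ℝ≥0∞) ^ α₂ * 2 ^ ((n : ℝ) / r.toReal) * levelNorm r p w j ψ := by
  have hscale : scale n (j + 1) r = 2 ^ ((n : ℝ) / r.toReal) * scale n j r := by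
    rw [scale, scale, ← two_rpow_add]
    push_cast
    ring_nf
  have hparent := hw.seqNorm_parent_le hp (Nat.le_succ j)
    fun M => scale n j r * eLpNorm ψ r (volume.restrict (dyadicCube j M))
  rw [Nat.cast_succ, add_sub_cancel_left, mul_one] at hparent
  calc levelNorm r p w (j + 1) ψ
      ≤ seqNorm p (fun m => 2 ^ ((n : ℝ) / r.toReal) * (w (j + 1) m * (scale n j r *
          eLpNorm ψ r (volume.restrict (dyadicCube j (parent (j + 1 - j) m)))))) :=
        seqNorm_mono hp fun m => by
          rw [hscale, mul_assoc (2 ^ _), mul_left_comm]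
          gcongr
          exact dyadicCube_subset_parent (Nat.le_succ j) m
    _ ≤ 2 ^ ((n : ℝ) / r.toReal) * (c * (2 : ℝ≥0∞) ^ α₂ * levelNorm r p w j ψ) := by
        rw [seqNorm_const_mul hp]
        gcongr
        exact hparent
    _ = _ := by ring

theorem exists_levelNorm_le_levelNorm_pred (n : ℕ) (hp : p ≠ 0) (r : ℝ≥0∞) (α₂ α₃ : ℝ) (c : ℝ≥0) :
    ∃ C : ℝ≥0, ∀ w : ℕ → (Fin n → ℤ) → ℝ≥0∞, IsCubeWeight α₂ α₃ c p w →
      ∀ j ψ, levelNorm r p w j ψ ≤ C * levelNorm r p w (j - 1) ψ := by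
  refine ⟨1 + c * 2 ^ α₂ * 2 ^ ((n : ℝ) / r.toReal), fun w hw j ψ => ?_⟩
  push_cast [ENNReal.coe_rpow_of_ne_zero (two_ne_zero (α := ℝ≥0))]
  rw [add_mul, one_mul]
  cases j with
  | zero => exact le_self_add
  | succ j => exact (hw.levelNorm_succ_le hp j ψ).trans le_add_self

section Triangle

variable {ν : ℝ} (hν : 0 < ν) (hν1 : ν ≤ 1) (hνr : ENNReal.ofReal ν ≤ r)
  (hνp : ENNReal.ofReal ν ≤ p)
include hν hν1 hνr hνp

theorem levelNorm_sub_rpow_le (k : ℕ) {f g : (Fin n → ℝ) → ℝ} (hf : AEStronglyMeasurable f volume)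
    (hg : AEStronglyMeasurable g volume) :
    levelNorm r p w k (f - g) ^ ν ≤ levelNorm r p w k f ^ ν + levelNorm r p w k g ^ ν := by
  have hcube (m : Fin n → ℤ) : eLpNorm (f - g) r (volume.restrict (dyadicCube k m)) ^ ν ≤
      ∑ i, eLpNorm (![f, g] i) r (volume.restrict (dyadicCube k m)) ^ ν :=
    eLpNorm_rpow_le_sum_of_enorm_le hν hν1 hνr
      (by simpa using ⟨hf.restrict, hg.restrict⟩)
      (Filter.Eventually.of_forall fun x => by simpa using enorm_sub_le)
  have hlevel : levelNorm r p w k (f - g) ^ ν ≤ ∑ i, levelNorm r p w k (![f, g] i) ^ ν :=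
    seqNorm_rpow_le_sum hν hνp fun m => by
      simp only [ENNReal.mul_rpow_of_nonneg _ _ hν.le, ← Finset.mul_sum]
      gcongr
      exact hcube m
  simpa using hlevel

theorem diffNorm_sum_rpow_le {ι : Type*} (k : ℕ) (s : Finset ι) {f : ι → (Fin n → ℝ) → ℝ}
    (hf : ∀ i ∈ s, AEStronglyMeasurable (f i) volume) :
    diffNorm l r p w k (∑ i ∈ s, f i) ^ ν ≤ ∑ i ∈ s, diffNorm l r p w k (f i) ^ ν := by
  refine seqNorm_rpow_le_sum hν hνp fun m => ?_
  simp only [delta_eq, ENNReal.mul_rpow_of_nonneg _ _ hν.le, ← Finset.mul_sum]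
  gcongr
  refine eLpNorm_rpow_le_sum_of_enorm_le hν hν1 hνr
    (fun i hi => aestronglyMeasurable_fwdDiff_iter m l (hf i hi))
    (Filter.Eventually.of_forall fun q => ?_)
  rw [fwdDiff_iter_finsetSum, Finset.sum_apply]
  exact enorm_sum_le _ _

theorem diffNorm_add_rpow_le (k : ℕ) {f g : (Fin n → ℝ) → ℝ} (hf : AEStronglyMeasurable f volume)
    (hg : AEStronglyMeasurable g volume) :
    diffNorm l r p w k (f + g) ^ ν ≤ diffNorm l r p w k f ^ ν + diffNorm l r p w k g ^ ν := by
  have h := diffNorm_sum_rpow_le (l := l) (w := w) hν hν1 hνr hνp k Finset.univ (f := ![f, g])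
    (by simpa using ⟨hf, hg⟩)
  simpa using h

end Triangle

end LevelNorm

/-! ### Telescoping -/

section Telescoping

variable {n l : ℕ} {p r : ℝ≥0∞} {lam : ℝ} {w : ℕ → (Fin n → ℤ) → ℝ≥0∞}
  {φ : (Fin n → ℝ) → ℝ} {S : ℕ → (Fin n → ℝ) → ℝ}

/-- A telescoping sequence of splines: `S (j + 1)` is a spline of level `j`, and `S 0 = 0` plays the
role of the spline of level `-1`. -/
def IsSplineSequence (n l : ℕ) (S : ℕ → (Fin n → ℝ) → ℝ) : Prop :=
  S 0 = 0 ∧ ∀ j, S (j + 1) ∈ splineSpace n l j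

/-- The weighted error `2^{(i - 1) λ} ‖φ - S_i‖` of the `i`-th member of a spline sequence, measured
at the level `i - 1` of `S_i` (at level `0` for `S_0 = 0`, by truncated subtraction). -/
noncomputable def splineError (r p : ℝ≥0∞) (w : ℕ → (Fin n → ℤ) → ℝ≥0∞) (lam : ℝ)
    (φ : (Fin n → ℝ) → ℝ) (S : ℕ → (Fin n → ℝ) → ℝ) (i : ℕ) : ℝ≥0∞ :=
  (2 : ℝ≥0∞) ^ (((i : ℝ) - 1) * lam) * levelNorm r p w (i - 1) (φ - S i)

/-- The weighted best approximations `2^{(i - 1) λ} s_{i-1}^{l+1}(φ)`, with the index shifted by one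
so that it starts at `0`. -/
noncomputable def approxTerm (l : ℕ) (r p : ℝ≥0∞) (w : ℕ → (Fin n → ℤ) → ℝ≥0∞) (lam : ℝ)
    (φ : (Fin n → ℝ) → ℝ) : ℕ → ℝ≥0∞
  | 0 => (2 : ℝ≥0∞) ^ (-lam) * levelNorm r p w 0 φ
  | j + 1 => (2 : ℝ≥0∞) ^ (j * lam) * bestApprox l r p w φ j

theorem zero_mem_splineSpace (n d k : ℕ) : (0 : (Fin n → ℝ) → ℝ) ∈ splineSpace n d k :=
  ⟨0, by simp⟩

theorem IsSplineSequence.hasLocalExpansion_succ_sub (hS : IsSplineSequence n l S) (j : ℕ) :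
    HasLocalExpansion l j (S (j + 1) - S j) := by
  refine (hasLocalExpansion_of_mem_splineSpace (hS.2 j) 0).sub ?_
  cases j with
  | zero => exact hasLocalExpansion_of_mem_splineSpace (hS.1 ▸ zero_mem_splineSpace n l 0) 0
  | succ j => exact hasLocalExpansion_of_mem_splineSpace (hS.2 j) 1

theorem IsSplineSequence.continuous (hS : IsSplineSequence n l S) (hl : 1 ≤ l) (j : ℕ) :
    Continuous (S j) := by
  cases j with
  | zero => rw [hS.1]; exact continuous_zero
  | succ j => exact (hasLocalExpansion_of_mem_splineSpace (hS.2 j) 0).continuous hl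

theorem IsSplineSequence.aestronglyMeasurable_sub (hS : IsSplineSequence n l S) (hl : 1 ≤ l)
    (hφ : AEStronglyMeasurable φ volume) (j : ℕ) : AEStronglyMeasurable (φ - S j) volume :=
  hφ.sub (hS.continuous hl j).aestronglyMeasurable

theorem splineError_succ (j : ℕ) : splineError r p w lam φ S (j + 1) =
    (2 : ℝ≥0∞) ^ (j * lam) * levelNorm r p w j (φ - S (j + 1)) := by
  simp [splineError]

theorem exists_splineError_le (l : ℕ) (r p : ℝ≥0∞) (w : ℕ → (Fin n → ℤ) → ℝ≥0∞) (lam : ℝ)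
    (φ : (Fin n → ℝ) → ℝ) {ε : ℝ≥0∞} (hε : 0 < ε) :
    ∃ S, IsSplineSequence n l S ∧ ∀ i,
      splineError r p w lam φ S i ≤ approxTerm l r p w lam φ i + 2 ^ (((i : ℝ) - 1) * lam) * ε := by
  have hnear (j : ℕ) :
      ∃ s ∈ splineSpace n l j, levelNorm r p w j (φ - s) ≤ bestApprox l r p w φ j + ε := by
    by_cases htop : bestApprox l r p w φ j = ∞
    · exact ⟨0, zero_mem_splineSpace n l j, by simp [htop]⟩
    · obtain ⟨s, hs⟩ := iInf_lt_iff.1 (ENNReal.lt_add_right htop hε.ne')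
      obtain ⟨hmem, hlt⟩ := iInf_lt_iff.1 hs
      exact ⟨s, hmem, hlt.le⟩
  choose s hs hle using hnear
  refine ⟨fun i => i.casesOn 0 s, ⟨rfl, hs⟩, fun i => ?_⟩
  cases i with
  | zero => simp [splineError, approxTerm]
  | succ j =>
    rw [splineError_succ, approxTerm, Nat.cast_succ, add_sub_cancel_right, ← mul_add]
    gcongr
    exact hle j

theorem le_mul_sum_rpow_of_forall_pos_le {ν : ℝ} (s : Finset ℕ) {C : ℝ≥0} {X : ℝ≥0∞}
    {a b : ℕ → ℝ≥0∞} (hb : ∀ i, b i ≠ ∞)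
    (h : ∀ ε : ℝ≥0∞, 0 < ε → X ≤ C * (∑ i ∈ s, (a i + b i * ε) ^ ν) ^ (1 / ν)) :
    X ≤ C * (∑ i ∈ s, a i ^ ν) ^ (1 / ν) := by
  have hcont : Continuous fun ε : ℝ≥0∞ => C * (∑ i ∈ s, (a i + b i * ε) ^ ν) ^ (1 / ν) :=
    (ENNReal.continuous_const_mul ENNReal.coe_ne_top).comp <|
      ENNReal.continuous_rpow_const.comp <| continuous_finsetSum s fun i _ =>
        ENNReal.continuous_rpow_const.comp <|
          continuous_const.add (ENNReal.continuous_const_mul (hb i))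
  have hlim := hcont.continuousWithinAt (s := Set.Ioi 0) (x := 0)
  simp only [ContinuousWithinAt, mul_zero, add_zero] at hlim
  exact ge_of_tendsto hlim (Filter.mem_of_superset self_mem_nhdsWithin h)

theorem sum_range_add_succ_le (a : ℕ → ℝ≥0∞) (k : ℕ) :
    ∑ j ∈ Finset.range (k + 1), (a j + a (j + 1)) ≤ 2 * ∑ i ∈ Finset.range (k + 2), a i := by
  rw [Finset.sum_add_distrib, two_mul]
  exact add_le_add (le_self_add.trans_eq (Finset.sum_range_succ a (k + 1)).symm)
    (le_self_add.trans_eq (Finset.sum_range_succ' a (k + 1)).symm)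

section Exponent

variable {ν : ℝ} (hν : 0 < ν) (hν1 : ν ≤ 1) (hνr : ENNReal.ofReal ν ≤ r)
  (hνp : ENNReal.ofReal ν ≤ p)
include hν hν1 hνr hνp

theorem exists_levelNorm_succ_sub_rpow_le (n : ℕ) (hl : 1 ≤ l) (hp : p ≠ 0) (α₂ α₃ lam : ℝ)
    (c : ℝ≥0) :
    ∃ D : ℝ≥0, ∀ w : ℕ → (Fin n → ℤ) → ℝ≥0∞, IsCubeWeight α₂ α₃ c p w →
      ∀ φ, AEStronglyMeasurable φ volume → ∀ S, IsSplineSequence n l S → ∀ j : ℕ,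
      ((2 : ℝ≥0∞) ^ (j * lam) * levelNorm r p w j (S (j + 1) - S j)) ^ ν ≤
        D ^ ν * (splineError r p w lam φ S j ^ ν + splineError r p w lam φ S (j + 1) ^ ν) := by
  obtain ⟨K, hK⟩ := exists_levelNorm_le_levelNorm_pred n hp r α₂ α₃ c
  refine ⟨K * 2 ^ lam + 1, fun w hw φ hφ S hS j => ?_⟩
  rw [ENNReal.coe_add, ENNReal.coe_mul, ENNReal.coe_rpow_of_ne_zero two_ne_zero, ENNReal.coe_ofNat,
    ENNReal.coe_one]
  have hsub : S (j + 1) - S j = (φ - S j) - (φ - S (j + 1)) := by abel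
  have hprev : (2 : ℝ≥0∞) ^ (j * lam) * levelNorm r p w j (φ - S j) ≤
      K * 2 ^ lam * splineError r p w lam φ S j := by
    have hpow : (2 : ℝ≥0∞) ^ (j * lam) = 2 ^ lam * 2 ^ (((j : ℝ) - 1) * lam) := by
      rw [← two_rpow_add]; congr 1; ring
    calc _ ≤ (2 : ℝ≥0∞) ^ (j * lam) * (K * levelNorm r p w (j - 1) (φ - S j)) := by
          gcongr; exact hK w hw j _
      _ = _ := by rw [hpow, splineError]; ring
  calc ((2 : ℝ≥0∞) ^ (j * lam) * levelNorm r p w j (S (j + 1) - S j)) ^ ν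
      ≤ ((2 : ℝ≥0∞) ^ (j * lam) * levelNorm r p w j (φ - S j)) ^ ν +
          ((2 : ℝ≥0∞) ^ (j * lam) * levelNorm r p w j (φ - S (j + 1))) ^ ν := by
        simp only [ENNReal.mul_rpow_of_nonneg _ _ hν.le, ← mul_add]
        rw [hsub]
        gcongr
        exact levelNorm_sub_rpow_le hν hν1 hνr hνp j (hS.aestronglyMeasurable_sub hl hφ j)
          (hS.aestronglyMeasurable_sub hl hφ (j + 1))
    _ ≤ ((K * 2 ^ lam + 1) * splineError r p w lam φ S j) ^ ν +
          ((K * 2 ^ lam + 1) * splineError r p w lam φ S (j + 1)) ^ ν := by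
        gcongr ?_ ^ ν + ?_ ^ ν
        · exact hprev.trans (by gcongr; exact le_self_add)
        · rw [← splineError_succ, add_mul, one_mul]
          exact le_add_self
    _ = _ := by rw [ENNReal.mul_rpow_of_nonneg _ _ hν.le, ENNReal.mul_rpow_of_nonneg _ _ hν.le,
        mul_add]

theorem exists_diffNorm_succ_sub_rpow_le (n : ℕ) (hl : 1 ≤ l) (hp : p ≠ 0) (hr : r ≠ 0)
    (α₂ α₃ : ℝ) (c : ℝ≥0) :
    ∃ D : ℝ≥0, ∀ w : ℕ → (Fin n → ℤ) → ℝ≥0∞, IsCubeWeight α₂ α₃ c p w →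
      ∀ φ, AEStronglyMeasurable φ volume → ∀ S, IsSplineSequence n l S → ∀ {j k : ℕ}, j ≤ k →
      ((2 : ℝ≥0∞) ^ (k * (l - α₂)) * diffNorm l r p w k (S (j + 1) - S j)) ^ ν ≤
        D ^ ν * (splineError r p w (l - α₂) φ S j ^ ν +
          splineError r p w (l - α₂) φ S (j + 1) ^ ν) := by
  obtain ⟨C, hC⟩ := exists_diffNorm_le_of_hasLocalExpansion n hl hp hr α₂ α₃ c
  obtain ⟨D, hD⟩ := exists_levelNorm_succ_sub_rpow_le hν hν1 hνr hνp n hl hp α₂ α₃ (l - α₂) c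
  refine ⟨C * D, fun w hw φ hφ S hS j k hjk => ?_⟩
  have hpow : (2 : ℝ≥0∞) ^ (k * (l - α₂)) * 2 ^ (((j : ℝ) - k) * (l - α₂)) =
      2 ^ (j * (l - α₂)) := by
    rw [← two_rpow_add]; congr 1; ring
  calc ((2 : ℝ≥0∞) ^ (k * (l - α₂)) * diffNorm l r p w k (S (j + 1) - S j)) ^ ν
      ≤ (2 ^ (k * (l - α₂)) * (C * 2 ^ (((j : ℝ) - k) * (l - α₂)) *
          levelNorm r p w j (S (j + 1) - S j))) ^ ν := by
        gcongr
        exact hC w hw hjk _ (hS.hasLocalExpansion_succ_sub j)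
    _ = C ^ ν * (2 ^ (j * (l - α₂)) * levelNorm r p w j (S (j + 1) - S j)) ^ ν := by
        rw [← ENNReal.mul_rpow_of_nonneg _ _ hν.le, ← hpow]; ring_nf
    _ ≤ C ^ ν * (D ^ ν * (splineError r p w (l - α₂) φ S j ^ ν +
          splineError r p w (l - α₂) φ S (j + 1) ^ ν)) := by
        gcongr
        exact hD w hw φ hφ S hS j
    _ = _ := by rw [ENNReal.coe_mul, ENNReal.mul_rpow_of_nonneg _ _ hν.le, mul_assoc]

theorem IsSplineSequence.diffNorm_rpow_le (hS : IsSplineSequence n l S) (hl : 1 ≤ l)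
    (hφ : AEStronglyMeasurable φ volume) (w : ℕ → (Fin n → ℤ) → ℝ≥0∞) (k : ℕ) :
    diffNorm l r p w k φ ^ ν ≤ diffNorm l r p w k (φ - S (k + 1)) ^ ν +
      ∑ j ∈ Finset.range (k + 1), diffNorm l r p w k (S (j + 1) - S j) ^ ν := by
  have htelescope : φ = (φ - S (k + 1)) + ∑ j ∈ Finset.range (k + 1), (S (j + 1) - S j) := by
    rw [Finset.sum_range_sub, hS.1]
    abel
  have hincrement (j : ℕ) : AEStronglyMeasurable (S (j + 1) - S j) volume :=
    (hS.hasLocalExpansion_succ_sub j).continuous hl |>.aestronglyMeasurable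
  conv_lhs => rw [htelescope]
  refine (diffNorm_add_rpow_le hν hν1 hνr hνp k (hS.aestronglyMeasurable_sub hl hφ _)
    (Finset.aestronglyMeasurable_sum _ fun j _ => hincrement j)).trans ?_
  gcongr
  exact diffNorm_sum_rpow_le hν hν1 hνr hνp k _ fun j _ => hincrement j

theorem exists_diffNorm_le_sum_splineError (n : ℕ) (hl : 1 ≤ l) (hp : p ≠ 0) (hr : r ≠ 0)
    (α₂ α₃ : ℝ) (c : ℝ≥0) :
    ∃ C : ℝ≥0, ∀ w : ℕ → (Fin n → ℤ) → ℝ≥0∞, IsCubeWeight α₂ α₃ c p w →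
      ∀ φ, AEStronglyMeasurable φ volume → ∀ S, IsSplineSequence n l S → ∀ k : ℕ,
      (2 : ℝ≥0∞) ^ (k * (l - α₂)) * diffNorm l r p w k φ ≤
        C * (∑ i ∈ Finset.range (k + 2), splineError r p w (l - α₂) φ S i ^ ν) ^ (1 / ν) := by
  obtain ⟨B, hB⟩ := exists_diffNorm_le_levelNorm n l hp hr α₂ α₃ c
  obtain ⟨D, hD⟩ := exists_diffNorm_succ_sub_rpow_le hν hν1 hνr hνp n hl hp hr α₂ α₃ c
  refine ⟨(B ^ ν + D ^ ν * 2) ^ (1 / ν), fun w hw φ hφ S hS k => ?_⟩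
  set e := splineError r p w (l - α₂) φ S
  set T := ∑ i ∈ Finset.range (k + 2), e i ^ ν
  have hlast : (2 ^ (k * (l - α₂)) * diffNorm l r p w k (φ - S (k + 1))) ^ ν ≤ B ^ ν * T := by
    calc _ ≤ (B * e (k + 1)) ^ ν := by
          rw [show e (k + 1) = _ from splineError_succ k, mul_left_comm (B : ℝ≥0∞)]
          gcongr
          exact hB w hw _ (hS.aestronglyMeasurable_sub hl hφ _) k
      _ ≤ _ := by
          rw [ENNReal.mul_rpow_of_nonneg _ _ hν.le]
          gcongr
          exact Finset.single_le_sum (f := fun i => e i ^ ν) (fun _ _ => zero_le) (by simp)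
  have hincrements : ∑ j ∈ Finset.range (k + 1),
      (2 ^ (k * (l - α₂)) * diffNorm l r p w k (S (j + 1) - S j)) ^ ν ≤ D ^ ν * 2 * T := by
    refine (Finset.sum_le_sum fun j hj =>
      hD w hw φ hφ S hS (Finset.mem_range_succ_iff.1 hj)).trans ?_
    rw [← Finset.mul_sum, mul_assoc]
    gcongr
    exact sum_range_add_succ_le (fun i => e i ^ ν) k
  rw [one_div, ← ENNReal.rpow_le_rpow_iff hν, ENNReal.coe_rpow_of_nonneg _ (inv_nonneg.2 hν.le),
    ← ENNReal.mul_rpow_of_nonneg _ _ (inv_nonneg.2 hν.le), ENNReal.rpow_inv_rpow hν.ne',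
    ENNReal.coe_add, ENNReal.coe_mul, ENNReal.coe_rpow_of_nonneg _ hν.le,
    ENNReal.coe_rpow_of_nonneg _ hν.le, add_mul]
  refine le_trans ?_ (add_le_add hlast hincrements)
  simp only [ENNReal.mul_rpow_of_nonneg _ _ hν.le, ← Finset.mul_sum, ← mul_add]
  gcongr
  exact hS.diffNorm_rpow_le hν hν1 hνr hνp hl hφ w k

theorem exists_diffNorm_le_sum_approxTerm (n : ℕ) (hl : 1 ≤ l) (hp : p ≠ 0) (hr : r ≠ 0)
    (α₂ α₃ : ℝ) (c : ℝ≥0) :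
    ∃ C : ℝ≥0, ∀ w : ℕ → (Fin n → ℤ) → ℝ≥0∞, IsCubeWeight α₂ α₃ c p w →
      ∀ φ, AEStronglyMeasurable φ volume → ∀ k : ℕ,
      (2 : ℝ≥0∞) ^ (k * (l - α₂)) * diffNorm l r p w k φ ≤
        C * (∑ i ∈ Finset.range (k + 2), approxTerm l r p w (l - α₂) φ i ^ ν) ^ (1 / ν) := by
  obtain ⟨C, hC⟩ := exists_diffNorm_le_sum_splineError hν hν1 hνr hνp n hl hp hr α₂ α₃ c
  refine ⟨C, fun w hw φ hφ k => ?_⟩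
  refine le_mul_sum_rpow_of_forall_pos_le (b := fun i => (2 : ℝ≥0∞) ^ (((i : ℝ) - 1) * (l - α₂)))
    _ (by simp [ENNReal.rpow_eq_top_iff]) fun ε hε => ?_
  obtain ⟨S, hS, hle⟩ := exists_splineError_le l r p w (l - α₂) φ hε
  refine (hC w hw φ hφ S hS k).trans ?_
  gcongr with i
  exact hle i

end Exponent

theorem sum_approxTerm_rpow {μ : ℝ} (hμ : 0 < μ) (lam : ℝ) (k : ℕ) :
    ∑ i ∈ Finset.range (k + 2), approxTerm l r p w lam φ i ^ μ =
      (2 : ℝ≥0∞) ^ ((-1 : ℝ) * μ * lam) * levelNorm r p w 0 φ ^ μ +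
        ∑ j ∈ Finset.range (k + 1),
          (2 : ℝ≥0∞) ^ ((j : ℝ) * μ * lam) * bestApprox l r p w φ j ^ μ := by
  rw [Finset.sum_range_succ', add_comm]
  simp only [approxTerm, ENNReal.mul_rpow_of_nonneg _ _ hμ.le, ← ENNReal.rpow_mul]
  congr! 3 with j
  all_goals ring_nf

end Telescoping

theorem LocLp.aestronglyMeasurable {n : ℕ} {r : ℝ≥0∞} {φ : (Fin n → ℝ) → ℝ} (hφ : LocLp φ r) :
    AEStronglyMeasurable φ volume := by
  have h : AEStronglyMeasurable φ (volume.restrict (⋃ N : ℕ, Metric.closedBall 0 (N : ℝ))) :=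
    aestronglyMeasurable_iUnion_iff.2 fun N => (hφ _ (isCompact_closedBall 0 (N : ℝ))).1
  rwa [Metric.iUnion_closedBall_nat, Measure.restrict_univ] at h

theorem splineApproxInit_eq {n : ℕ} (r p : ℝ≥0∞) (t : ℕ → (Fin n → ℝ) → ℝ) (φ : (Fin n → ℝ) → ℝ) :
    splineApproxInit r p t φ = levelNorm r p (assoc p t) 0 φ := by
  simp [splineApproxInit, levelNorm, scale]

end VarSmooth

theorem theorem4p2_general (n l : ℕ) (hl : 1 ≤ l) (p r : ℝ≥0∞) (hp : p ≠ 0) (hr : r ≠ 0)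
    (α₂ α₃ : ℝ) (c : ℝ≥0) :
    ∃ C : ℝ≥0, 0 < C ∧
      ∀ w : ℕ → (Fin n → ℤ) → ℝ≥0∞, VarSmooth.IsCubeWeight α₂ α₃ c p w →
      ∀ φ : (Fin n → ℝ) → ℝ, AEStronglyMeasurable φ volume →
      ∀ μ : ℝ, 0 < μ → μ ≤ 1 → ENNReal.ofReal μ ≤ r → ENNReal.ofReal μ ≤ p →
      ∀ k : ℕ,
        VarSmooth.diffNorm l r p w k φ ≤
          (C : ℝ≥0∞) * (2 : ℝ≥0∞) ^ (-(k : ℝ) * ((l : ℝ) - α₂)) *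
            ((2 : ℝ≥0∞) ^ ((-1 : ℝ) * μ * ((l : ℝ) - α₂)) *
                VarSmooth.levelNorm r p w 0 φ ^ μ +
              ∑ j ∈ Finset.range (k + 1),
                (2 : ℝ≥0∞) ^ ((j : ℝ) * μ * ((l : ℝ) - α₂)) *
                  VarSmooth.bestApprox l r p w φ j ^ μ) ^ (1 / μ) := by
  obtain ⟨ν, hν, ⟨hν1, hνr, hνp⟩, hmax⟩ := VarSmooth.exists_isGreatest_exponent hr hp
  obtain ⟨C, hC⟩ :=
    VarSmooth.exists_diffNorm_le_sum_approxTerm hν hν1 hνr hνp n hl hp hr α₂ α₃ c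
  refine ⟨C + 1, by positivity, fun w hw φ hφ μ hμ hμ1 hμr hμp k => ?_⟩
  rw [← VarSmooth.sum_approxTerm_rpow hμ]
  have hpow : (2 : ℝ≥0∞) ^ (-(k : ℝ) * ((l : ℝ) - α₂)) * 2 ^ (k * ((l : ℝ) - α₂)) = 1 := by
    rw [← VarSmooth.two_rpow_add, neg_mul, neg_add_cancel, ENNReal.rpow_zero]
  calc VarSmooth.diffNorm l r p w k φ
      = 2 ^ (-(k : ℝ) * ((l : ℝ) - α₂)) *
          (2 ^ (k * ((l : ℝ) - α₂)) * VarSmooth.diffNorm l r p w k φ) := by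
        rw [← mul_assoc, hpow, one_mul]
    _ ≤ 2 ^ (-(k : ℝ) * ((l : ℝ) - α₂)) * ((C + 1 : ℝ≥0) * (∑ i ∈ Finset.range (k + 2),
          VarSmooth.approxTerm l r p w (l - α₂) φ i ^ μ) ^ (1 / μ)) := by
        refine mul_le_mul_right
          ((hC w hw φ hφ k).trans (mul_le_mul' (ENNReal.coe_le_coe.2 le_self_add) ?_)) _
        exact VarSmooth.rpow_sum_rpow_antitone _ _ hμ (hmax ⟨hμ1, hμr, hμp⟩)
    _ = _ := by rw [← mul_assoc, mul_comm (2 ^ _)]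

theorem theorem4p2 (n l : ℕ) (hn : 1 ≤ n) (hl : 1 ≤ l)
    (p r σ₁ : ℝ≥0∞) (hp : 0 < p) (hr : 0 < r) (hσ₁ : 0 < σ₁)
    (α₁ α₂ α₃ : ℝ) (hα₃ : 0 ≤ α₃) (c₁ c₂ : ℝ) (hc₁ : 0 < c₁) (hc₂ : 0 < c₂) :
    ∃ C : ℝ≥0, 0 < C ∧
      ∀ t : ℕ → (Fin n → ℝ) → ℝ, VarSmooth.IsXClass α₁ α₂ α₃ σ₁ p p c₁ c₂ t →
      ∀ φ : (Fin n → ℝ) → ℝ, VarSmooth.LocLp φ r →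
      ∀ μ : ℝ, 0 < μ → μ ≤ 1 → ENNReal.ofReal μ ≤ r → ENNReal.ofReal μ ≤ p →
      ∀ k : ℕ,
        VarSmooth.seqNorm p (fun m : Fin n → ℤ =>
            VarSmooth.assoc p t k m *
              VarSmooth.delta l r (VarSmooth.corner k m) ((2 ^ k : ℝ)⁻¹) φ)
          ≤ (C : ℝ≥0∞) * (2 : ℝ≥0∞) ^ (-(k : ℝ) * ((l : ℝ) - α₂)) *
            ((2 : ℝ≥0∞) ^ ((-1 : ℝ) * μ * ((l : ℝ) - α₂)) *
                VarSmooth.splineApproxInit r p t φ ^ μ +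
              ∑ j ∈ Finset.range (k + 1),
                (2 : ℝ≥0∞) ^ ((j : ℝ) * μ * ((l : ℝ) - α₂)) *
                  VarSmooth.splineApprox (l + 1) r p t φ j ^ μ) ^ (1 / μ) := by
  obtain ⟨C, hC, h⟩ := theorem4p2_general n l hl p r hp.ne' hr.ne' α₂ α₃ c₂.toNNReal
  refine ⟨C, hC, fun t ht φ hφ => ?_⟩
  rw [VarSmooth.splineApproxInit_eq]
  exact h _ (ht.isCubeWeight hp.ne') φ hφ.aestronglyMeasurable
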